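/- **Setting.** Let $\mathcal A$ be a finite action set and $\mathcal Y$ a measurable outcome space (e.g. a Euclidean space or a compact subset of one). Let $\nu$ be a measure on $\mathcal Y$. For each $a\in\mathcal A$ the true outcome distribution $Q^*(\cdot|a)$ has a positive density $q^*(\cdot|a)$ with respect to $\nu$, and the payoff $u(a,\cdot)$ is $Q^*(\cdot|a)$-integrable. Fix a discount factor $\delta\in[0,1)$ and a switching threshold $\alpha>1$. A *model* $\theta$ consists of a finite nonempty parameter set $\Omega^\theta$ in a Euclidean space and, for all $a\in\mathcal A$, $\omega\in\Omega^\theta$, a probability distribution $Q^\theta(\cdot|a,\omega)$ with positive density $q^\theta(\cdot|a,\omega)$ with respect to $\nu$, such that $u(a,\cdot)$ is $Q^\theta(\cdot|a,\omega)$-integrable and $|\ln (q^*(\cdot|a)/q^\theta(\cdot|a,\omega))|\le g$ holds $Q^*(\cdot|a)$-a.s. for some $g\in L^2(Q^*(\cdot|a))$. Let $\Theta$ be the set of all models. Write $B^\theta(a,y,\pi)$ for the Bayesian posterior on $\Omega^\theta$ from belief $\pi\in\Delta\Omega^\theta$ after action $a$ and outcome $y$, and let $U^\theta$ be the bounded measurable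 solution of $$U^\theta(\pi)=\max_{a\in\mathcal A}\sum_{\omega\in\Omega^\theta}\pi(\omega)\int_{\mathcal Y}\bigl[u(a,y)+\delta\,U^\theta(B^\theta(a,y,\pi))\bigr]q^\theta(y|a,\omega)\,\nu(dy).$$ An *optimal policy* $a^\theta:\Delta\Omega^\theta\to\mathcal A$ is a measurable selection of maximizers. Let $A^\theta_m(\pi)$ be the set of maximizers of the problem with $\delta=0$ (the myopically optimal actions). **Switching.** A switcher has an initial model $\theta$, a competing model $\theta^c$, a full-support prior $\pi_0$ over the parameters of each, and an optimal policy for each. Let $l_t^{\theta'}=\sum_{\omega}\pi_0^{\theta'}(\omega)\prod_{\tau<t}q^{\theta'}(y_\tau|a_\tau,\omega)$. The model choice starts at $m_0=\theta$. In each period $t\ge1$ she switches from $m_{t-1}$ to the other model $\theta'$ if $l_t^{\theta'}/l_t^{m_{t-1}}>\alpha$, and otherwise keeps $m_t=m_{t-1}$. She then plays the action that the policy of $m_t$ prescribes at the posterior over $\Omega^{m_t}$ obtained from its prior and the full history, and the outcome is drawn (independently across periods) from $Q^*(\cdot|a_t)$. Model $\theta$ *persists against* $\theta^c$ (at the given priors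 and policies) if with positive probability $m_t=\theta$ for all sufficiently large $t$. Model $\theta$ is *globally robust* if there exist a full-support prior and an optimal policy for $\theta$ under which $\theta$ persists against every $\theta^c\in\Theta$ at every full-support prior and every optimal policy for $\theta^c$. **Equilibrium.** For $\sigma\in\Delta\mathcal A$, let $\Omega^\theta(\sigma)$ be the set of minimizers over $\omega\in\Omega^\theta$ of $\sum_a\sigma(a)D_{KL}(q^*(\cdot|a)\,\|\,q^\theta(\cdot|a,\omega))$. The strategy $\sigma$ is a *self-confirming equilibrium* under $\theta$ if there is a belief $\pi\in\Delta\Omega^\theta(\sigma)$ with $\operatorname{supp}\sigma\subseteq A^\theta_m(\pi)$ and $q^*(\cdot|a)=q^\theta(\cdot|a,\omega)$ ($\nu$-a.e.) for all $\omega\in\operatorname{supp}\pi$ and $a\in\operatorname{supp}\sigma$. It is *uniformly quasi-strict* if $\operatorname{supp}\sigma=A^\theta_m(\pi)$ for every $\pi\in\Delta\Omega^\theta(\sigma)$. **Corollary.** If a model $\theta\in\Theta$ admits a uniformly quasi-strict self-confirming equilibrium, then $\theta$ is globally robust. -/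

import Mathlib

open MeasureTheory Filter

noncomputable section

/-- The measure with density `f` with respect to `ν`. -/
def densityLaw {Y : Type*} [MeasurableSpace Y] (ν : Measure Y) (f : Y → ℝ) : Measure Y :=
  ν.withDensity (fun y => ENNReal.ofReal (f y))

/-- The objective environment: a dominating measure `ν`, the (positive) densities `q a` of the
true data generating process given each action, and a flow payoff `u` that is integrable under
the true data generating process. -/
structure Environment (A Y : Type*) [Fintype A] [MeasurableSpace Y] where
  ν : Measure Y
  q : A → Y → ℝ
  u : A → Y → ℝ
  q_measurable : ∀ a, Measurable (q a)
  q_pos : ∀ a y, 0 < q a y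
  q_prob : ∀ a, IsProbabilityMeasure (densityLaw ν (q a))
  u_integrable : ∀ a, Integrable (u a) (densityLaw ν (q a))

namespace Environment

variable {A Y : Type*} [Fintype A] [MeasurableSpace Y]

/-- The true conditional outcome distribution given action `a`. -/
def law (E : Environment A Y) (a : A) : Measure Y := densityLaw E.ν (E.q a)

instance (E : Environment A Y) (a : A) : IsProbabilityMeasure (E.law a) := E.q_prob a

/-- The underlying probability measure: independent draws `s (a, t)` from the true distribution
given `a`, one for every action `a` and period `t`. -/
def prob (E : Environment A Y) : Measure (A × ℕ → Y) :=
  Measure.infinitePi (fun p : A × ℕ => E.law p.1)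

end Environment

/-- A subjective model: a finite nonempty parameter set in a Euclidean space and positive
conditional densities, with integrable payoffs and a square-integrable bound on the
log-likelihood ratio between the true and the predicted densities. -/
structure SubjectiveModel {A Y : Type*} [Fintype A] [MeasurableSpace Y]
    (E : Environment A Y) where
  dim : ℕ
  Ω : Finset (EuclideanSpace ℝ (Fin dim))
  Ω_nonempty : Ω.Nonempty
  q : A → Ω → Y → ℝ
  q_measurable : ∀ a ω, Measurable (q a ω)
  q_pos : ∀ a ω y, 0 < q a ω y
  q_prob : ∀ a ω, IsProbabilityMeasure (densityLaw E.ν (q a ω))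
  u_integrable : ∀ a ω, Integrable (E.u a) (densityLaw E.ν (q a ω))
  log_ratio_bound : ∀ a ω, ∃ g : Y → ℝ, MemLp g 2 (E.law a) ∧
    ∀ᵐ y ∂(E.law a), |Real.log (E.q a y / q a ω y)| ≤ g y

/-- Which of the two models the switcher currently adopts. -/
inductive ModelLabel where
  | initial : ModelLabel
  | competing : ModelLabel

namespace SubjectiveModel

variable {A Y : Type*} [Fintype A] [MeasurableSpace Y] {E : Environment A Y}

/-- Beliefs: probability vectors over the parameter set. -/
abbrev Belief (θ : SubjectiveModel E) : Type := stdSimplex ℝ θ.Ω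

/-- A prior has full support. -/
def FullSupport (θ : SubjectiveModel E) (π : θ.Belief) : Prop := ∀ ω, 0 < π.1 ω

/-- The predicted outcome distribution given action `a` and parameter `ω`. -/
def law (θ : SubjectiveModel E) (a : A) (ω : θ.Ω) : Measure Y := densityLaw E.ν (θ.q a ω)

/-- The predictive density of outcome `y` given action `a` under the belief `π`. -/
def predictive (θ : SubjectiveModel E) (a : A) (y : Y) (π : θ.Belief) : ℝ :=
  ∑ ω, π.1 ω * θ.q a ω y

theorem predictive_pos (θ : SubjectiveModel E) (a : A) (y : Y) (π : θ.Belief) :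
    0 < θ.predictive a y π := by
  have h0 : ∀ ω ∈ Finset.univ, 0 ≤ π.1 ω * θ.q a ω y := fun ω _ =>
    mul_nonneg (π.2.1 ω) (θ.q_pos a ω y).le
  refine lt_of_le_of_ne (Finset.sum_nonneg h0) (fun h => ?_)
  have h1 := (Finset.sum_eq_zero_iff_of_nonneg h0).1 h.symm
  have h2 : ∑ ω, π.1 ω = 0 := Finset.sum_eq_zero (fun ω hω => by
    rcases mul_eq_zero.1 (h1 ω hω) with h3 | h3
    · exact h3
    · exact absurd h3 (θ.q_pos a ω y).ne')
  rw [π.2.2] at h2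
  exact one_ne_zero h2

/-- The Bayesian operator. -/
def bayes (θ : SubjectiveModel E) (a : A) (y : Y) (π : θ.Belief) : θ.Belief :=
  ⟨fun ω => π.1 ω * θ.q a ω y / θ.predictive a y π,
    fun ω => div_nonneg (mul_nonneg (π.2.1 ω) (θ.q_pos a ω y).le) (θ.predictive_pos a y π).le,
    by
      rw [← Finset.sum_div]
      exact div_self (θ.predictive_pos a y π).ne'⟩

/-- The objective of the dynamic program at continuation value `U`: the subjectively expected
flow payoff plus discounted continuation value of action `a` at belief `π`. -/
def objective (θ : SubjectiveModel E) (δ : ℝ) (U : θ.Belief → ℝ) (π : θ.Belief) (a : A) : ℝ :=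
  ∑ ω, π.1 ω * ∫ y, (E.u a y + δ * U (θ.bayes a y π)) ∂(θ.law a ω)

/-- `U` is the value function: the bounded measurable solution of the Bellman equation. -/
def IsValueFunction (θ : SubjectiveModel E) (δ : ℝ) (U : θ.Belief → ℝ) : Prop :=
  Measurable U ∧ (∃ C, ∀ π, |U π| ≤ C) ∧
    ∀ π, IsGreatest (Set.range (θ.objective δ U π)) (U π)

/-- The set of dynamically optimal actions at belief `π`. -/
def optimalActions (θ : SubjectiveModel E) (δ : ℝ) (π : θ.Belief) : Set A :=
  {a | ∃ U, θ.IsValueFunction δ U ∧ ∀ a', θ.objective δ U π a' ≤ θ.objective δ U π a}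

/-- The set of myopically optimal actions at belief `π` (the case `δ = 0`). -/
def myopicActions (θ : SubjectiveModel E) (π : θ.Belief) : Set A :=
  {a | ∀ a', ∑ ω, π.1 ω * ∫ y, E.u a' y ∂(θ.law a' ω) ≤
    ∑ ω, π.1 ω * ∫ y, E.u a y ∂(θ.law a ω)}

/-- A (measurable) pure optimal policy. -/
def IsOptimalPolicy (θ : SubjectiveModel E) (δ : ℝ) (f : θ.Belief → A) : Prop :=
  (∀ a, MeasurableSet (f ⁻¹' {a})) ∧ ∀ π, f π ∈ θ.optimalActions δ π

/-- Likelihood of a history under the prior `π₀`. Histories are lists of action-outcome pairs,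
the most recent pair first. -/
def likelihood (θ : SubjectiveModel E) (π₀ : θ.Belief) (h : List (A × Y)) : ℝ :=
  ∑ ω, π₀.1 ω * (h.map (fun p => θ.q p.1 ω p.2)).prod

/-- The posterior after a history. -/
def posterior (θ : SubjectiveModel E) (π₀ : θ.Belief) : List (A × Y) → θ.Belief
  | [] => π₀
  | p :: h => θ.bayes p.1 p.2 (posterior θ π₀ h)

open Classical in
/-- The switcher's model choice after a history, by the Bayes factor rule with threshold `α`:
she abandons the last period's model exactly if the Bayes factor of the other model exceeds `α`.
(The Bayes factor of the last period's model is `1`, which is less than `α`.) -/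
def modelChoice (θ θc : SubjectiveModel E) (α : ℝ) (π₀ : θ.Belief) (π₀c : θc.Belief) :
    List (A × Y) → ModelLabel
  | [] => ModelLabel.initial
  | p :: h =>
    match modelChoice θ θc α π₀ π₀c h with
    | ModelLabel.initial =>
      if α < θc.likelihood π₀c (p :: h) / θ.likelihood π₀ (p :: h)
      then ModelLabel.competing else ModelLabel.initial
    | ModelLabel.competing =>
      if α < θ.likelihood π₀ (p :: h) / θc.likelihood π₀c (p :: h)
      then ModelLabel.initial else ModelLabel.competing

/-- The switcher's action after a history: the policy of the adopted model at the posterior of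
that model. -/
def switcherAction (θ θc : SubjectiveModel E) (α : ℝ) (π₀ : θ.Belief) (π₀c : θc.Belief)
    (f : θ.Belief → A) (fc : θc.Belief → A) (h : List (A × Y)) : A :=
  match modelChoice θ θc α π₀ π₀c h with
  | ModelLabel.initial => f (θ.posterior π₀ h)
  | ModelLabel.competing => fc (θc.posterior π₀c h)

/-- The switcher's history at the beginning of period `t`, given all potential outcomes `s`. -/
def switcherHistory (θ θc : SubjectiveModel E) (α : ℝ) (π₀ : θ.Belief) (π₀c : θc.Belief)
    (f : θ.Belief → A) (fc : θc.Belief → A) (s : A × ℕ → Y) : ℕ → List (A × Y)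
  | 0 => []
  | t + 1 =>
    let h := switcherHistory θ θc α π₀ π₀c f fc s t
    let a := switcherAction θ θc α π₀ π₀c f fc h
    (a, s (a, t)) :: h

/-- The initial model `θ` persists against `θc`: with positive probability the model choice
converges to `θ`, that is, it is eventually always `θ`. -/
def PersistsAgainst (θ θc : SubjectiveModel E) (α : ℝ) (π₀ : θ.Belief) (π₀c : θc.Belief)
    (f : θ.Belief → A) (fc : θc.Belief → A) : Prop :=
  0 < E.prob {s | ∀ᶠ t in atTop, modelChoice θ θc α π₀ π₀c
    (switcherHistory θ θc α π₀ π₀c f fc s t) = ModelLabel.initial}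

/-- Global robustness, for discount factor `δ` and switching threshold `α`. -/
def GloballyRobust (θ : SubjectiveModel E) (δ α : ℝ) : Prop :=
  ∃ π₀ : θ.Belief, θ.FullSupport π₀ ∧ ∃ f : θ.Belief → A, θ.IsOptimalPolicy δ f ∧
    ∀ (θc : SubjectiveModel E) (π₀c : θc.Belief), θc.FullSupport π₀c →
      ∀ fc : θc.Belief → A, θc.IsOptimalPolicy δ fc →
        PersistsAgainst θ θc α π₀ π₀c f fc

/-- The support of a mixed strategy. -/
def strategySupport (σ : stdSimplex ℝ A) : Set A := {a | 0 < σ.1 a}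

/-- The `σ`-weighted Kullback-Leibler divergence of the true distributions from those predicted
by the parameter `ω`. -/
def weightedKL (θ : SubjectiveModel E) (σ : stdSimplex ℝ A) (ω : θ.Ω) : ENNReal :=
  ∑ a, ENNReal.ofReal (σ.1 a) * InformationTheory.klDiv (E.law a) (θ.law a ω)

/-- The set of KL minimizers at `σ`. -/
def klMinimizers (θ : SubjectiveModel E) (σ : stdSimplex ℝ A) : Set θ.Ω :=
  {ω | ∀ ω', θ.weightedKL σ ω ≤ θ.weightedKL σ ω'}

/-- The belief `π` is concentrated on the KL minimizers at `σ`. -/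
def SupportedOnKLMinimizers (θ : SubjectiveModel E) (σ : stdSimplex ℝ A) (π : θ.Belief) : Prop :=
  ∀ ω, 0 < π.1 ω → ω ∈ θ.klMinimizers σ

/-- Berk-Nash equilibrium. -/
def IsBerkNash (θ : SubjectiveModel E) (σ : stdSimplex ℝ A) : Prop :=
  ∃ π : θ.Belief, θ.SupportedOnKLMinimizers σ π ∧ strategySupport σ ⊆ θ.myopicActions π

/-- Uniformly quasi-strict Berk-Nash equilibrium. -/
def IsUniformlyQuasiStrict (θ : SubjectiveModel E) (σ : stdSimplex ℝ A) : Prop :=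
  θ.IsBerkNash σ ∧ ∀ π : θ.Belief, θ.SupportedOnKLMinimizers σ π →
    strategySupport σ = θ.myopicActions π

/-- Self-confirming equilibrium. -/
def IsSelfConfirming (θ : SubjectiveModel E) (σ : stdSimplex ℝ A) : Prop :=
  θ.IsBerkNash σ ∧ ∃ π : θ.Belief, θ.SupportedOnKLMinimizers σ π ∧
    strategySupport σ ⊆ θ.myopicActions π ∧
    ∀ ω, 0 < π.1 ω → ∀ a ∈ strategySupport σ, E.q a =ᵐ[E.ν] θ.q a ω

end SubjectiveModel

end

open scoped ENNReal

/-! ### Maximal inequality and measurable selection -/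

noncomputable section

/-! Let `S` be the support of the equilibrium and `O` the set of KL minimizers at it.
Self-confirmation makes the minimal divergence zero, so every parameter in `O` predicts the truth
under every action in `S`. Quasi-strictness at point beliefs on `O` makes `S` exactly the set of
myopically optimal actions at each such parameter.

Beliefs close to `O` leave little to learn. The expected posterior is the prior, so functions linear
in the belief are reproduced by the continuation operator. The value function is therefore squeezed
between two linear functions whose gap is proportional to the mass outside `O`. An action outside
`S` costs an amount proportional to the mass of `O`. Hence when the odds against `O` are below some
`η`, only actions in `S` are dynamically optimal (`exists_optimalActions_subset`).

While actions stay in `S`, the likelihood of each parameter in `O` relative to the truth remains 1.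
The odds against `O` and the competitor's Bayes factor are then controlled by averages of likelihood
ratios, which are nonnegative martingales whatever rule picks the actions. Ville's inequality for
one mixture of all these ratios shows that with positive probability neither bound is ever violated,
and on that event the initial model is never abandoned (`persistsAgainst_of_concentrated`). The
prior needs only enough mass on `O` relative to `η` and `α`, so one prior serves against every
competitor; this is where `1 < α` enters. -/

/-- Ville's maximal inequality for nonnegative supermartingales. -/
theorem measure_exists_one_le_of_supermartingale {Ω : Type*} {m : MeasurableSpace Ω}
    (μ : Measure Ω) [IsProbabilityMeasure μ] (ℱ : Filtration ℕ m) (Z : ℕ → Ω → ℝ≥0∞)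
    (hZ : ∀ t, Measurable[ℱ t] (Z t))
    (h : ∀ t B, MeasurableSet[ℱ t] B → ∫⁻ x in B, Z (t + 1) x ∂μ ≤ ∫⁻ x in B, Z t x ∂μ) :
    μ {x | ∃ t, 1 ≤ Z t x} ≤ ∫⁻ x, Z 0 x ∂μ := by
  -- No crossing up to time `t`. Integrating over `N t` replaces stopping the process at its first
  -- crossing.
  set N : ℕ → Set Ω := fun t => {x | ∀ k ≤ t, Z k x < 1} with hN
  have hlt : ∀ t, MeasurableSet[ℱ t] {x | Z t x < 1} := fun t =>
    hZ t measurableSet_Iio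
  have hsucc : ∀ t, N (t + 1) = N t ∩ {x | Z (t + 1) x < 1} := by
    intro t
    ext x
    simp only [hN, Set.mem_ofPred_eq, Set.mem_inter_iff]
    constructor
    · exact fun hx => ⟨fun k hk => hx k (by omega), hx _ le_rfl⟩
    · rintro ⟨h1, h2⟩ k hk
      rcases Nat.lt_or_ge k (t + 1) with hk' | hk'
      · exact h1 k (by omega)
      · obtain rfl : k = t + 1 := by omega
        exact h2
  have hzero : N 0 = {x | Z 0 x < 1} := by
    ext x; simp [hN]
  have hNm : ∀ t, MeasurableSet[ℱ t] (N t) := by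
    intro t
    induction t with
    | zero => rw [hzero]; exact hlt 0
    | succ t ih =>
      rw [hsucc]
      exact MeasurableSet.inter (ℱ.mono (Nat.le_succ t) _ ih) (hlt _)
  have hNm' : ∀ t, MeasurableSet (N t) := fun t => ℱ.le t _ (hNm t)
  have hZ' : ∀ t, Measurable (Z t) := fun t => (hZ t).mono (ℱ.le t) le_rfl
  have hdiff : ∀ t (B : Set Ω), MeasurableSet B →
      μ (B \ {x | Z t x < 1}) + ∫⁻ x in B ∩ {x | Z t x < 1}, Z t x ∂μ
        ≤ ∫⁻ x in B, Z t x ∂μ := by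
    intro t B hB
    have hm : MeasurableSet {x | Z t x < 1} := ℱ.le t _ (hlt t)
    rw [← lintegral_inter_add_sdiff (Z t) B hm, add_comm]
    gcongr
    calc μ (B \ {x | Z t x < 1}) = ∫⁻ x in B \ {x | Z t x < 1}, 1 ∂μ := by simp
      _ ≤ _ := setLIntegral_mono (hZ' t) (fun x hx => not_lt.1 hx.2)
  -- Bounds the mean of the stopped process, with its value at a crossing counted as 1.
  have key : ∀ t, μ (N t)ᶜ + ∫⁻ x in N t, Z t x ∂μ ≤ ∫⁻ x, Z 0 x ∂μ := by
    intro t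
    induction t with
    | zero =>
      have := hdiff 0 Set.univ MeasurableSet.univ
      rw [Set.univ_inter, ← Set.compl_eq_univ_sdiff, Measure.restrict_univ] at this
      rwa [hzero]
    | succ t ih =>
      refine le_trans ?_ ih
      have h1 : (N (t + 1))ᶜ ⊆ (N t)ᶜ ∪ (N t \ {x | Z (t + 1) x < 1}) := by
        intro x hx
        by_cases hxt : x ∈ N t
        · refine Or.inr ⟨hxt, fun hx2 => hx ?_⟩
          rw [hsucc]; exact ⟨hxt, hx2⟩
        · exact Or.inl hxt
      calc μ (N (t + 1))ᶜ + ∫⁻ x in N (t + 1), Z (t + 1) x ∂μ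
          ≤ (μ (N t)ᶜ + μ (N t \ {x | Z (t + 1) x < 1}))
            + ∫⁻ x in N t ∩ {x | Z (t + 1) x < 1}, Z (t + 1) x ∂μ := by
            rw [hsucc t]
            rw [hsucc t] at h1
            gcongr
            exact (measure_mono h1).trans (measure_union_le _ _)
        _ ≤ μ (N t)ᶜ + ∫⁻ x in N t, Z (t + 1) x ∂μ := by
            rw [add_assoc]
            gcongr
            exact hdiff _ _ (hNm' t)
        _ ≤ _ := by
            exact add_le_add le_rfl (h t _ (hNm t))
  have hU : {x | ∃ t, 1 ≤ Z t x} ⊆ ⋃ t, (N t)ᶜ := by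
    rintro x ⟨t, ht⟩
    exact Set.mem_iUnion.2 ⟨t, fun hx => not_lt.2 ht (hx t le_rfl)⟩
  have hmono : Monotone fun t => (N t)ᶜ :=
    fun i j hij => Set.compl_subset_compl.2 fun x hx k hk => hx k (hk.trans hij)
  refine (measure_mono hU).trans ?_
  rw [hmono.measure_iUnion]
  exact iSup_le fun t => le_self_add.trans (key t)

/-- A measurable selection of maximizers from finitely many measurable objectives. -/
theorem exists_measurable_argmax {X A : Type*} [MeasurableSpace X] [Fintype A] [Nonempty A]
    (g : A → X → ℝ) (hg : ∀ a, Measurable (g a)) :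
    ∃ f : X → A, (∀ a, MeasurableSet (f ⁻¹' {a})) ∧ ∀ x a, g a x ≤ g (f x) x := by
  classical
  -- Ties are broken by an arbitrary linear order: taking the least maximizer makes each fibre a
  -- finite Boolean combination of argmax sets.
  have e := Fintype.equivFin A
  let : LinearOrder A := LinearOrder.lift' e e.injective
  have hne : ∀ x, (Finset.univ.filter fun a => ∀ a', g a' x ≤ g a x).Nonempty := by
    intro x
    obtain ⟨a, -, ha⟩ := Finset.exists_max_image Finset.univ (fun a => g a x)
      Finset.univ_nonempty
    exact ⟨a, by simpa using fun a' => ha a' (Finset.mem_univ _)⟩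
  have hmax : ∀ a, MeasurableSet {x | ∀ a', g a' x ≤ g a x} := by
    intro a
    rw [Set.ofPred_forall]
    exact MeasurableSet.iInter fun a' => measurableSet_le (hg a') (hg a)
  refine ⟨fun x => (Finset.univ.filter fun a => ∀ a', g a' x ≤ g a x).min' (hne x), ?_, ?_⟩
  · intro a
    have : (fun x => (Finset.univ.filter fun a => ∀ a', g a' x ≤ g a x).min' (hne x)) ⁻¹' {a}
        = {x | ∀ a', g a' x ≤ g a x} ∩ ⋂ b : {b // b < a}, {x | ∀ a', g a' x ≤ g b x}ᶜ := by
      ext x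
      rw [Set.mem_preimage, Set.mem_singleton_iff, Finset.min'_eq_iff]
      simp only [Finset.mem_filter, Finset.mem_univ, true_and, Set.mem_inter_iff,
        Set.mem_iInter, Set.mem_compl_iff, Set.mem_ofPred_eq, Subtype.forall]
      refine and_congr_right fun _ => forall_congr' fun b => ?_
      rw [← not_lt]
      tauto
    rw [this]
    exact (hmax a).inter (MeasurableSet.iInter fun b => (hmax b).compl)
  · intro x
    have := Finset.min'_mem _ (hne x)
    exact (Finset.mem_filter.1 this).2

/-! ### Potential outcomes and independence of the past -/

namespace Environment

variable {A Y : Type*} [MeasurableSpace Y]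

/-- The information generated by the potential outcomes before each period. -/
def pastFiltration (A Y : Type*) [MeasurableSpace Y] :
    Filtration ℕ (MeasurableSpace.pi : MeasurableSpace (A × ℕ → Y)) where
  seq t := ⨆ p ∈ {p : A × ℕ | p.2 < t}, MeasurableSpace.comap (fun s => s p) inferInstance
  mono' _ _ hij := biSup_mono fun _ hp => lt_of_lt_of_le hp hij
  le' _ := iSup₂_le fun p _ => (measurable_pi_apply p).comap_le

theorem measurable_coordinate (a : A) (t : ℕ) :
    Measurable[pastFiltration A Y (t + 1)] fun s : A × ℕ → Y => s (a, t) := by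
  refine measurable_iff_comap_le.2 ?_
  exact le_biSup (fun p : A × ℕ => MeasurableSpace.comap (fun s : A × ℕ → Y => s p) inferInstance)
    (show (a, t) ∈ {p : A × ℕ | p.2 < t + 1} from Nat.lt_succ_self t)

variable [Fintype A]

instance (E : Environment A Y) : IsProbabilityMeasure E.prob := by
  unfold prob; infer_instance

theorem measurePreserving_coordinate (E : Environment A Y) (p : A × ℕ) :
    MeasurePreserving (fun s : A × ℕ → Y => s p) E.prob (E.law p.1) :=
  measurePreserving_eval_infinitePi (fun p : A × ℕ => E.law p.1) p

/-- The past involves only coordinates of periods before `t`, a set disjoint from `{(a, t)}` in a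
product measure. -/
theorem indep_past_coordinate (E : Environment A Y) (a : A) (t : ℕ) :
    ProbabilityTheory.Indep (pastFiltration A Y t)
      (MeasurableSpace.comap (fun s : A × ℕ → Y => s (a, t)) inferInstance) E.prob := by
  have h := ProbabilityTheory.iIndepFun_infinitePi (P := fun p : A × ℕ => E.law p.1)
    (X := fun _ y => y) (fun _ => measurable_id)
  have h2 := ProbabilityTheory.indep_iSup_of_disjoint
    (fun p : A × ℕ => (measurable_pi_apply p).comap_le) h.iIndep
    (S := {p : A × ℕ | p.2 < t}) (T := {(a, t)}) (by simp)
  rw [iSup_singleton] at h2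
  exact h2

theorem lintegral_past_mul_coordinate (E : Environment A Y) (a : A) (t : ℕ)
    {g : (A × ℕ → Y) → ℝ≥0∞} (hg : Measurable[pastFiltration A Y t] g)
    {r : Y → ℝ≥0∞} (hr : Measurable r) :
    ∫⁻ s, g s * r (s (a, t)) ∂E.prob = (∫⁻ s, g s ∂E.prob) * ∫⁻ y, r y ∂E.law a := by
  rw [← (E.measurePreserving_coordinate (a, t)).lintegral_comp hr]
  exact ProbabilityTheory.lintegral_mul_eq_lintegral_mul_lintegral_of_independent_measurableSpace
    ((pastFiltration A Y).le t) (measurable_pi_apply (a, t)).comap_le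
    (E.indep_past_coordinate a t) hg (hr.comp (comap_measurable _))

/-- The expectation of a likelihood ratio is unaffected by one more outcome, whatever rule
based on past information chooses the action. -/
theorem setLIntegral_mul_chosen_coordinate (E : Environment A Y) (t : ℕ)
    {c : (A × ℕ → Y) → A} (hc : ∀ a, MeasurableSet[pastFiltration A Y t] (c ⁻¹' {a}))
    {g : (A × ℕ → Y) → ℝ≥0∞} (hg : Measurable[pastFiltration A Y t] g)
    {r : A → Y → ℝ≥0∞} (hr : ∀ a, Measurable (r a)) (hr1 : ∀ a, ∫⁻ y, r a y ∂E.law a = 1)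
    {B : Set (A × ℕ → Y)} (hB : MeasurableSet[pastFiltration A Y t] B) :
    ∫⁻ s in B, g s * r (c s) (s (c s, t)) ∂E.prob = ∫⁻ s in B, g s ∂E.prob := by
  classical
  have hind : ∀ a, Measurable[pastFiltration A Y t] ((B ∩ c ⁻¹' {a}).indicator g) :=
    fun a => Measurable.indicator hg (MeasurableSet.inter hB (hc a))
  have hle := (pastFiltration A Y).le t
  -- Partition by the chosen action. On each piece the outcome is a fixed coordinate, independent of
  -- the past that determines the piece.
  have hsplit : ∀ k : A → (A × ℕ → Y) → ℝ≥0∞, (∀ s, B.indicator (fun s => k (c s) s) s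
      = ∑ a, (B ∩ c ⁻¹' {a}).indicator (k a) s) := by
    intro k s
    rw [Finset.sum_eq_single (c s)]
    · by_cases hs : s ∈ B
      · rw [Set.indicator_of_mem hs, Set.indicator_of_mem (show s ∈ B ∩ c ⁻¹' {c s} from ⟨hs, rfl⟩)]
      · rw [Set.indicator_of_notMem hs, Set.indicator_of_notMem fun h => hs h.1]
    · intro a _ ha
      exact Set.indicator_of_notMem (fun h => ha h.2.symm) _
    · simp
  rw [← lintegral_indicator (hle _ hB), ← lintegral_indicator (hle _ hB)]
  simp_rw [hsplit fun a s => g s * r a (s (a, t)), hsplit fun _ => g]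
  have hmul : ∀ a s, (B ∩ c ⁻¹' {a}).indicator (fun s => g s * r a (s (a, t))) s
      = (B ∩ c ⁻¹' {a}).indicator g s * r a (s (a, t)) := by
    intro a s
    rw [Set.indicator_mul_left]
  simp_rw [hmul]
  rw [lintegral_finsetSum, lintegral_finsetSum]
  · refine Finset.sum_congr rfl fun a _ => ?_
    rw [E.lintegral_past_mul_coordinate a t (hind a) (hr a), hr1, mul_one]
  · exact fun a _ => (hind a).mono hle le_rfl
  · exact fun a _ => ((hind a).mono hle le_rfl).mul ((hr a).comp (measurable_pi_apply _))

end Environment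

/-! ### Beliefs and the continuation operator -/

namespace SubjectiveModel

variable {A Y : Type*} [Fintype A] [MeasurableSpace Y] {E : Environment A Y}

instance (θ : SubjectiveModel E) (a : A) (ω : θ.Ω) : IsProbabilityMeasure (θ.law a ω) :=
  θ.q_prob a ω

/-- The subjectively expected flow payoff of action `a` under the parameter `ω`. -/
def payoff (θ : SubjectiveModel E) (a : A) (ω : θ.Ω) : ℝ := ∫ y, E.u a y ∂(θ.law a ω)

/-- The subjectively expected continuation value of action `a` at belief `π`. -/
def continuation (θ : SubjectiveModel E) (U : θ.Belief → ℝ) (a : A) (π : θ.Belief) : ℝ :=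
  ∑ ω, π.1 ω * ∫ y, U (θ.bayes a y π) ∂(θ.law a ω)

/-- The expectation under a belief. -/
def mean (θ : SubjectiveModel E) (c : θ.Ω → ℝ) (π : θ.Belief) : ℝ := ∑ ω, π.1 ω * c ω

/-- Measurable and bounded value functions. -/
def IsBoundedMeasurable (θ : SubjectiveModel E) (U : θ.Belief → ℝ) : Prop :=
  Measurable U ∧ ∃ C, ∀ π, |U π| ≤ C

variable (θ : SubjectiveModel E)

theorem measurable_belief_apply (ω : θ.Ω) : Measurable fun π : θ.Belief => π.1 ω :=
  (measurable_pi_apply ω).comp measurable_subtype_coe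

theorem belief_le_one (π : θ.Belief) (ω : θ.Ω) : π.1 ω ≤ 1 := by
  rw [← π.2.2]
  exact Finset.single_le_sum (fun i _ => π.2.1 i) (Finset.mem_univ ω)

theorem measurable_mean (c : θ.Ω → ℝ) : Measurable (θ.mean c) :=
  Finset.measurable_fun_sum _ fun ω _ => (θ.measurable_belief_apply ω).mul_const _

theorem mean_mono {c d : θ.Ω → ℝ} (h : ∀ ω, c ω ≤ d ω) (π : θ.Belief) :
    θ.mean c π ≤ θ.mean d π :=
  Finset.sum_le_sum fun ω _ => mul_le_mul_of_nonneg_left (h ω) (π.2.1 ω)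

theorem mean_const (D : ℝ) (π : θ.Belief) : θ.mean (fun _ => D) π = D := by
  unfold mean
  rw [← Finset.sum_mul, π.2.2, one_mul]

theorem mean_add (c d : θ.Ω → ℝ) (π : θ.Belief) :
    θ.mean (fun ω => c ω + d ω) π = θ.mean c π + θ.mean d π := by
  simp only [mean, mul_add, Finset.sum_add_distrib]

theorem mean_sub (c d : θ.Ω → ℝ) (π : θ.Belief) :
    θ.mean (fun ω => c ω - d ω) π = θ.mean c π - θ.mean d π := by
  simp only [mean, mul_sub, Finset.sum_sub_distrib]

theorem mean_const_mul (k : ℝ) (c : θ.Ω → ℝ) (π : θ.Belief) :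
    θ.mean (fun ω => k * c ω) π = k * θ.mean c π := by
  simp only [mean, Finset.mul_sum]
  exact Finset.sum_congr rfl fun ω _ => by ring

theorem isBoundedMeasurable_mean (c : θ.Ω → ℝ) : θ.IsBoundedMeasurable (θ.mean c) := by
  refine ⟨θ.measurable_mean c, ∑ ω, |c ω|, fun π => ?_⟩
  refine (Finset.abs_sum_le_sum_abs _ _).trans (Finset.sum_le_sum fun ω _ => ?_)
  rw [abs_mul, abs_of_nonneg (π.2.1 ω)]
  exact mul_le_of_le_one_left (abs_nonneg _) (θ.belief_le_one π ω)

theorem measurable_bayes (a : A) : Measurable fun p : θ.Belief × Y => θ.bayes a p.2 p.1 := by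
  have h : ∀ ω, Measurable fun p : θ.Belief × Y => p.1.1 ω * θ.q a ω p.2 := fun ω =>
    ((θ.measurable_belief_apply ω).comp measurable_fst).mul
      ((θ.q_measurable a ω).comp measurable_snd)
  exact (measurable_pi_lambda _ fun ω =>
    (h ω).div (Finset.measurable_fun_sum _ fun ω _ => h ω)).subtype_mk

theorem integrable_continuation {U : θ.Belief → ℝ} (hU : θ.IsBoundedMeasurable U) (a : A)
    (π : θ.Belief) (ω : θ.Ω) : Integrable (fun y => U (θ.bayes a y π)) (θ.law a ω) := by
  obtain ⟨hm, C, hC⟩ := hU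
  refine Integrable.of_bound
    (hm.comp ((θ.measurable_bayes a).comp measurable_prodMk_left)).aestronglyMeasurable C ?_
  exact Eventually.of_forall fun y => hC _

/-- The integral splits because payoffs are integrable under every parameter and bounded measurable
continuation values are too. -/
theorem objective_eq {U : θ.Belief → ℝ} (hU : θ.IsBoundedMeasurable U) (δ : ℝ) (π : θ.Belief)
    (a : A) : θ.objective δ U π a = θ.mean (θ.payoff a) π + δ * θ.continuation U a π := by
  unfold objective mean continuation payoff
  rw [Finset.mul_sum, ← Finset.sum_add_distrib]
  refine Finset.sum_congr rfl fun ω _ => ?_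
  have hu : Integrable (E.u a) (θ.law a ω) := θ.u_integrable a ω
  rw [integral_add hu ((θ.integrable_continuation hU a π ω).const_mul δ),
    integral_const_mul]
  ring

theorem continuation_mono {U V : θ.Belief → ℝ} (hU : θ.IsBoundedMeasurable U)
    (hV : θ.IsBoundedMeasurable V) (h : ∀ π, U π ≤ V π) (a : A) (π : θ.Belief) :
    θ.continuation U a π ≤ θ.continuation V a π :=
  Finset.sum_le_sum fun ω _ => mul_le_mul_of_nonneg_left
    (integral_mono (θ.integrable_continuation hU a π ω) (θ.integrable_continuation hV a π ω)
      fun _ => h _) (π.2.1 ω)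

theorem integral_law_eq (a : A) (ω : θ.Ω) (f : Y → ℝ) :
    ∫ y, f y ∂(θ.law a ω) = ∫ y, θ.q a ω y * f y ∂E.ν := by
  unfold law densityLaw
  rw [integral_withDensity_eq_integral_toReal_smul (θ.q_measurable a ω).ennreal_ofReal
    (by simp)]
  refine integral_congr_ae (Eventually.of_forall fun y => ?_)
  simp [ENNReal.toReal_ofReal (θ.q_pos a ω y).le]

theorem integrable_density_mul (a : A) (ω : θ.Ω) {f : Y → ℝ}
    (hf : Integrable f (θ.law a ω)) : Integrable (fun y => θ.q a ω y * f y) E.ν := by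
  unfold law densityLaw at hf
  rw [integrable_withDensity_iff_integrable_smul' (θ.q_measurable a ω).ennreal_ofReal
    (by simp)] at hf
  refine hf.congr (Eventually.of_forall fun y => ?_)
  simp [ENNReal.toReal_ofReal (θ.q_pos a ω y).le]

/-- The expected posterior is the prior. -/
theorem continuation_apply (ω' : θ.Ω) (a : A) (π : θ.Belief) :
    θ.continuation (fun π => π.1 ω') a π = π.1 ω' := by
  have hB : θ.IsBoundedMeasurable fun π => π.1 ω' :=
    ⟨θ.measurable_belief_apply ω', 1, fun π => by
      rw [abs_of_nonneg (π.2.1 ω')]; exact θ.belief_le_one π ω'⟩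
  have h1 : ∫ y, θ.q a ω' y ∂E.ν = 1 := by
    have := θ.integral_law_eq a ω' fun _ => 1
    simpa using this.symm
  unfold continuation
  simp_rw [θ.integral_law_eq, ← integral_const_mul]
  rw [← integral_finsetSum _ fun ω _ =>
    (θ.integrable_density_mul a ω (θ.integrable_continuation hB a π ω)).const_mul _]
  rw [← mul_one (π.1 ω'), ← h1, ← integral_const_mul]
  refine integral_congr_ae (Eventually.of_forall fun y => ?_)
  have hp := (θ.predictive_pos a y π).ne'
  -- Averaging over `ω` produces the predictive density, which cancels the normalizer in Bayes'
  -- rule.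
  calc ∑ ω, π.1 ω * (θ.q a ω y * (π.1 ω' * θ.q a ω' y / θ.predictive a y π))
      = θ.predictive a y π * (π.1 ω' * θ.q a ω' y / θ.predictive a y π) := by
        conv_rhs => rw [predictive, Finset.sum_mul]
        exact Finset.sum_congr rfl fun ω _ => by rw [predictive]; ring
    _ = π.1 ω' * θ.q a ω' y := by field_simp

/-- The martingale property of posteriors extends by linearity. For linear candidates, Bellman
inequalities thus reduce to inequalities at each parameter. -/
theorem continuation_mean (c : θ.Ω → ℝ) (a : A) (π : θ.Belief) :
    θ.continuation (θ.mean c) a π = θ.mean c π := by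
  have hB : ∀ ω', θ.IsBoundedMeasurable fun π => π.1 ω' := fun ω' =>
    ⟨θ.measurable_belief_apply ω', 1, fun π => by
      rw [abs_of_nonneg (π.2.1 ω')]; exact θ.belief_le_one π ω'⟩
  have h : ∀ ω, ∫ y, θ.mean c (θ.bayes a y π) ∂(θ.law a ω)
      = ∑ ω', (∫ y, (θ.bayes a y π).1 ω' ∂(θ.law a ω)) * c ω' := by
    intro ω
    unfold mean
    rw [integral_finsetSum _ fun ω' _ =>
      (θ.integrable_continuation (hB ω') a π ω).mul_const _]
    simp_rw [integral_mul_const]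
  unfold continuation
  simp_rw [h, Finset.mul_sum]
  rw [Finset.sum_comm]
  refine Finset.sum_congr rfl fun ω' _ => ?_
  conv_rhs => rw [← θ.continuation_apply ω' a π, continuation, Finset.sum_mul]
  exact Finset.sum_congr rfl fun ω _ => by ring

theorem abs_continuation_sub_le {U V : θ.Belief → ℝ} (hU : θ.IsBoundedMeasurable U)
    (hV : θ.IsBoundedMeasurable V) {D : ℝ} (h : ∀ π, |U π - V π| ≤ D) (a : A) (π : θ.Belief) :
    |θ.continuation U a π - θ.continuation V a π| ≤ D := by
  unfold continuation
  rw [← Finset.sum_sub_distrib, ← θ.mean_const D π]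
  refine (Finset.abs_sum_le_sum_abs _ _).trans (Finset.sum_le_sum fun ω _ => ?_)
  rw [← mul_sub, abs_mul, abs_of_nonneg (π.2.1 ω), ← integral_sub
    (θ.integrable_continuation hU a π ω) (θ.integrable_continuation hV a π ω)]
  refine mul_le_mul_of_nonneg_left ?_ (π.2.1 ω)
  have := norm_integral_le_of_norm_le_const (μ := θ.law a ω)
    (f := fun y => U (θ.bayes a y π) - V (θ.bayes a y π)) (C := D)
    (Eventually.of_forall fun y => h _)
  simpa using this

theorem isBoundedMeasurable_continuation {U : θ.Belief → ℝ} (hU : θ.IsBoundedMeasurable U)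
    (a : A) : θ.IsBoundedMeasurable (θ.continuation U a) := by
  constructor
  · refine Finset.measurable_fun_sum _ fun ω _ => (θ.measurable_belief_apply ω).mul ?_
    have hm : StronglyMeasurable fun p : θ.Belief × Y => U (θ.bayes a p.2 p.1) :=
      (hU.1.comp (θ.measurable_bayes a)).stronglyMeasurable
    exact hm.integral_prod_right'.measurable
  · obtain ⟨-, C, hC⟩ := id hU
    refine ⟨C, fun π => ?_⟩
    have h0 := θ.isBoundedMeasurable_mean fun _ => 0
    have := θ.abs_continuation_sub_le hU h0 (D := C)
      (fun π => by rw [θ.mean_const, sub_zero]; exact hC π) a π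
    rwa [θ.continuation_mean, θ.mean_const, sub_zero] at this

/-! ### Existence of value functions and optimal policies -/

section ValueFunction

variable [Nonempty A]

/-- The Bellman operator. -/
def bellman (δ : ℝ) (U : θ.Belief → ℝ) (π : θ.Belief) : ℝ :=
  Finset.univ.sup' Finset.univ_nonempty
    fun a => θ.mean (θ.payoff a) π + δ * θ.continuation U a π

theorem isBoundedMeasurable_bellman (δ : ℝ) {U : θ.Belief → ℝ}
    (hU : θ.IsBoundedMeasurable U) : θ.IsBoundedMeasurable (θ.bellman δ U) := by
  have hm : ∀ a, Measurable fun π => θ.mean (θ.payoff a) π + δ * θ.continuation U a π :=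
    fun a => (θ.measurable_mean _).add ((θ.isBoundedMeasurable_continuation hU a).1.const_mul δ)
  constructor
  · have := Finset.measurable_sup' (Finset.univ_nonempty (α := A)) (fun a _ => hm a)
    convert this using 1
    ext π
    simp [bellman, Finset.sup'_apply]
  · choose C hC using fun a => (θ.isBoundedMeasurable_continuation hU a).2
    choose C' hC' using fun a => (θ.isBoundedMeasurable_mean (θ.payoff a)).2
    refine ⟨∑ a, (C' a + |δ| * C a), fun π => ?_⟩
    obtain ⟨a, -, ha⟩ := Finset.exists_mem_eq_sup' (Finset.univ_nonempty (α := A))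
      fun a => θ.mean (θ.payoff a) π + δ * θ.continuation U a π
    have hb : ∀ a, |θ.mean (θ.payoff a) π + δ * θ.continuation U a π| ≤ C' a + |δ| * C a := by
      intro a
      refine (abs_add_le _ _).trans (add_le_add (hC' a π) ?_)
      rw [abs_mul]
      exact mul_le_mul_of_nonneg_left (hC a π) (abs_nonneg _)
    rw [bellman, ha]
    exact (hb a).trans (Finset.single_le_sum
      (f := fun a => C' a + |δ| * C a) (fun a _ => (abs_nonneg _).trans (hb a)) (Finset.mem_univ a))

theorem bellman_le_bellman_add {δ : ℝ} (hδ : 0 ≤ δ) {U V : θ.Belief → ℝ}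
    (hU : θ.IsBoundedMeasurable U) (hV : θ.IsBoundedMeasurable V) {D : ℝ}
    (h : ∀ π, |U π - V π| ≤ D) (π : θ.Belief) :
    θ.bellman δ U π ≤ θ.bellman δ V π + δ * D := by
  refine Finset.sup'_le _ _ fun a _ => ?_
  have h1 := (abs_le.1 (θ.abs_continuation_sub_le hU hV h a π)).2
  have h2 := Finset.le_sup' (fun a => θ.mean (θ.payoff a) π + δ * θ.continuation V a π)
    (Finset.mem_univ a)
  have h3 := mul_le_mul_of_nonneg_left h1 hδ
  change _ ≤ θ.bellman δ V π at h2
  linarith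

theorem abs_bellman_sub_le {δ : ℝ} (hδ : 0 ≤ δ) {U V : θ.Belief → ℝ}
    (hU : θ.IsBoundedMeasurable U) (hV : θ.IsBoundedMeasurable V) {D : ℝ}
    (h : ∀ π, |U π - V π| ≤ D) (π : θ.Belief) :
    |θ.bellman δ U π - θ.bellman δ V π| ≤ δ * D := by
  have h1 := θ.bellman_le_bellman_add hδ hU hV h π
  have h2 := θ.bellman_le_bellman_add hδ hV hU (fun π => by rw [abs_sub_comm]; exact h π) π
  rw [abs_le]
  constructor <;> linarith

/-- Value iteration from zero: the Bellman operator contracts by `δ`, so the iterates converge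
geometrically and uniformly, and the limit inherits measurability and boundedness. -/
theorem exists_isValueFunction {δ : ℝ} (hδ0 : 0 ≤ δ) (hδ1 : δ < 1) :
    ∃ U, θ.IsValueFunction δ U := by
  set W : ℕ → θ.Belief → ℝ := fun n => (θ.bellman δ)^[n] (θ.mean fun _ => 0) with hWdef
  have hW : ∀ n, W (n + 1) = θ.bellman δ (W n) := fun n => Function.iterate_succ_apply' _ _ _
  have hbm : ∀ n, θ.IsBoundedMeasurable (W n) := by
    intro n
    induction n with
    | zero => exact θ.isBoundedMeasurable_mean _
    | succ n ih => rw [hW]; exact θ.isBoundedMeasurable_bellman δ ih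
  obtain ⟨D, hD⟩ := (hbm 1).2
  have hstep : ∀ n π, |W (n + 1) π - W n π| ≤ D * δ ^ n := by
    intro n
    induction n with
    | zero =>
      intro π
      have : W 0 π = 0 := θ.mean_const 0 π
      simpa [this] using hD π
    | succ n ih =>
      intro π
      rw [hW (n + 1)]
      nth_rewrite 2 [hW n]
      have := θ.abs_bellman_sub_le hδ0 (hbm (n + 1)) (hbm n) ih π
      rw [pow_succ]
      linarith
  have hdist : ∀ π n, dist (W n π) (W (n + 1) π) ≤ D * δ ^ n := by
    intro π n
    rw [Real.dist_eq, abs_sub_comm]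
    exact hstep n π
  choose U hlim using fun π =>
    cauchySeq_tendsto_of_complete (cauchySeq_of_le_geometric δ D hδ1 (hdist π))
  have herr : ∀ n π, |U π - W n π| ≤ D * δ ^ n / (1 - δ) := by
    intro n π
    have := dist_le_of_le_geometric_of_tendsto δ D hδ1 (hdist π) (hlim π) n
    rwa [Real.dist_eq, abs_sub_comm] at this
  have hUm : Measurable U :=
    measurable_of_tendsto_metrizable (fun n => (hbm n).1) (tendsto_pi_nhds.2 hlim)
  have hUb : ∃ C, ∀ π, |U π| ≤ C := by
    refine ⟨D * δ ^ 0 / (1 - δ), fun π => ?_⟩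
    have h0 : W 0 π = 0 := θ.mean_const 0 π
    have := herr 0 π
    rwa [h0, sub_zero] at this
  have hU : θ.IsBoundedMeasurable U := ⟨hUm, hUb⟩
  have hfix : ∀ π, θ.bellman δ U π = U π := by
    intro π
    refine tendsto_nhds_unique (f := fun n => W (n + 1) π) (l := atTop) ?_
      ((tendsto_add_atTop_iff_nat 1).2 (hlim π))
    rw [tendsto_iff_dist_tendsto_zero]
    refine squeeze_zero (g := fun n => δ * (D * δ ^ n / (1 - δ))) (fun _ => dist_nonneg)
      (fun n => ?_) ?_
    · rw [Real.dist_eq, abs_sub_comm, hW]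
      exact θ.abs_bellman_sub_le hδ0 hU (hbm n) (herr n) π
    · have := ((tendsto_pow_atTop_nhds_zero_of_lt_one hδ0 hδ1).const_mul D).div_const (1 - δ)
      simpa using this.const_mul δ
  refine ⟨U, hUm, hUb, fun π => ?_⟩
  rw [← hfix π]
  constructor
  · obtain ⟨a, -, ha⟩ := Finset.exists_mem_eq_sup' (Finset.univ_nonempty (α := A))
      fun a => θ.mean (θ.payoff a) π + δ * θ.continuation U a π
    exact ⟨a, (θ.objective_eq hU δ π a).trans ha.symm⟩
  · rintro _ ⟨a, rfl⟩
    rw [θ.objective_eq hU]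
    exact Finset.le_sup' (fun a => θ.mean (θ.payoff a) π + δ * θ.continuation U a π)
      (Finset.mem_univ a)

theorem exists_isOptimalPolicy {δ : ℝ} (hδ0 : 0 ≤ δ) (hδ1 : δ < 1) :
    ∃ f, θ.IsOptimalPolicy δ f := by
  obtain ⟨U, hU⟩ := θ.exists_isValueFunction hδ0 hδ1
  have hbm : θ.IsBoundedMeasurable U := ⟨hU.1, hU.2.1⟩
  obtain ⟨f, hf, hmax⟩ := exists_measurable_argmax
    (fun a π => θ.mean (θ.payoff a) π + δ * θ.continuation U a π)
    (fun a => (θ.measurable_mean _).add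
      ((θ.isBoundedMeasurable_continuation hbm a).1.const_mul δ))
  refine ⟨f, hf, fun π => ⟨U, hU, fun a' => ?_⟩⟩
  rw [θ.objective_eq hbm, θ.objective_eq hbm]
  exact hmax π a'

end ValueFunction

/-! ### Linear bounds on the value function and optimal actions near `O` -/

theorem isBoundedMeasurable_of_isValueFunction {θ : SubjectiveModel E} {δ : ℝ}
    {U : θ.Belief → ℝ} (hU : θ.IsValueFunction δ U) : θ.IsBoundedMeasurable U :=
  ⟨hU.1, hU.2.1⟩

theorem nonpos_of_forall_le_geometric {x D δ : ℝ} (hδ0 : 0 ≤ δ) (hδ1 : δ < 1)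
    (h : ∀ n : ℕ, x ≤ D * δ ^ n) : x ≤ 0 := by
  have := (tendsto_pow_atTop_nhds_zero_of_lt_one hδ0 hδ1).const_mul D
  rw [mul_zero] at this
  exact ge_of_tendsto' this h

/-- A linear subsolution of the Bellman equation lies below the value function. -/
theorem mean_le_of_isValueFunction {δ : ℝ} (hδ0 : 0 ≤ δ) (hδ1 : δ < 1) {U : θ.Belief → ℝ}
    (hU : θ.IsValueFunction δ U) (c : θ.Ω → ℝ) (a : A)
    (h : ∀ ω, c ω ≤ θ.payoff a ω + δ * c ω) (π : θ.Belief) : θ.mean c π ≤ U π := by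
  have hbm := isBoundedMeasurable_of_isValueFunction hU
  obtain ⟨C, hC⟩ := hU.2.1
  obtain ⟨C', hC'⟩ := (θ.isBoundedMeasurable_mean c).2
  -- A uniform bound on the violation is multiplied by `δ` with each application of the Bellman
  -- equation, hence vanishes.
  have key : ∀ (n : ℕ) π, θ.mean c π - U π ≤ (C' + C) * δ ^ n := by
    intro n
    induction n with
    | zero =>
      intro π
      have h1 := (abs_le.1 (hC π)).1
      have h2 := (abs_le.1 (hC' π)).2
      simp; linarith
    | succ n ih =>
      intro π
      have h1 : θ.objective δ U π a ≤ U π := (hU.2.2 π).2 ⟨a, rfl⟩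
      rw [θ.objective_eq hbm] at h1
      have h2 := θ.continuation_mono
        (θ.isBoundedMeasurable_mean fun ω => c ω - (C' + C) * δ ^ n) hbm
        (fun π => by rw [θ.mean_sub, θ.mean_const]; linarith [ih π]) a π
      rw [θ.continuation_mean, θ.mean_sub, θ.mean_const] at h2
      have h3 := θ.mean_mono h π
      rw [θ.mean_add, θ.mean_const_mul] at h3
      have h4 := mul_le_mul_of_nonneg_left h2 hδ0
      rw [pow_succ]
      linarith
  have := nonpos_of_forall_le_geometric hδ0 hδ1 fun n => key n π
  linarith

/-- A linear supersolution of the Bellman equation lies above the value function. -/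
theorem le_mean_of_isValueFunction {δ : ℝ} (hδ0 : 0 ≤ δ) (hδ1 : δ < 1) {U : θ.Belief → ℝ}
    (hU : θ.IsValueFunction δ U) (c : θ.Ω → ℝ)
    (h : ∀ a ω, θ.payoff a ω + δ * c ω ≤ c ω) (π : θ.Belief) : U π ≤ θ.mean c π := by
  have hbm := isBoundedMeasurable_of_isValueFunction hU
  obtain ⟨C, hC⟩ := hU.2.1
  obtain ⟨C', hC'⟩ := (θ.isBoundedMeasurable_mean c).2
  have key : ∀ (n : ℕ) π, U π - θ.mean c π ≤ (C' + C) * δ ^ n := by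
    intro n
    induction n with
    | zero =>
      intro π
      have h1 := (abs_le.1 (hC π)).2
      have h2 := (abs_le.1 (hC' π)).1
      simp; linarith
    | succ n ih =>
      intro π
      obtain ⟨a, h1⟩ := (hU.2.2 π).1
      rw [θ.objective_eq hbm] at h1
      have h2 := θ.continuation_mono hbm
        (θ.isBoundedMeasurable_mean fun ω => c ω + (C' + C) * δ ^ n)
        (fun π => by rw [θ.mean_add, θ.mean_const]; linarith [ih π]) a π
      rw [θ.continuation_mean, θ.mean_add, θ.mean_const] at h2
      have h3 := θ.mean_mono (h a) π
      rw [θ.mean_add, θ.mean_const_mul] at h3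
      have h4 := mul_le_mul_of_nonneg_left h2 hδ0
      rw [pow_succ]
      linarith
  have := nonpos_of_forall_le_geometric hδ0 hδ1 fun n => key n π
  linarith

open Classical in
/-- If the actions in `S` are myopically optimal at every parameter in `O` and the other actions
are not, then at beliefs with high odds of `O` only actions in `S` are dynamically optimal. -/
theorem exists_optimalActions_subset {δ : ℝ} (hδ0 : 0 ≤ δ) (hδ1 : δ < 1) (O : Set θ.Ω)
    (S : Set A) (a₀ : A) (hle : ∀ ω ∈ O, ∀ a, θ.payoff a ω ≤ θ.payoff a₀ ω)
    (hlt : ∀ ω ∈ O, ∀ a ∉ S, θ.payoff a ω < θ.payoff a₀ ω) :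
    ∃ η > 0, ∀ π : θ.Belief,
      θ.mean (fun ω => if ω ∈ O then 0 else 1) π < η * θ.mean (fun ω => if ω ∈ O then 1 else 0) π →
      θ.optimalActions δ π ⊆ S := by
  obtain ⟨K, hK0, hK⟩ : ∃ K : ℝ, 0 ≤ K ∧ ∀ a ω, |θ.payoff a ω - θ.payoff a₀ ω| ≤ K := by
    refine ⟨∑ a, ∑ ω, |θ.payoff a ω - θ.payoff a₀ ω|, by positivity, fun a ω => ?_⟩
    refine le_trans ?_ (Finset.single_le_sum
      (f := fun a => ∑ ω, |θ.payoff a ω - θ.payoff a₀ ω|)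
      (fun _ _ => Finset.sum_nonneg fun _ _ => abs_nonneg _) (Finset.mem_univ a))
    exact Finset.single_le_sum (f := fun ω => |θ.payoff a ω - θ.payoff a₀ ω|)
      (fun _ _ => abs_nonneg _) (Finset.mem_univ ω)
  obtain ⟨g, hg0, hg⟩ : ∃ g : ℝ, 0 < g ∧ ∀ ω ∈ O, ∀ a ∉ S,
      θ.payoff a ω + g ≤ θ.payoff a₀ ω := by
    have hfin : ∀ s : Finset (A × θ.Ω), ∃ g : ℝ, 0 < g ∧ ∀ p ∈ s, p.2 ∈ O → p.1 ∉ S →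
        θ.payoff p.1 p.2 + g ≤ θ.payoff a₀ p.2 := by
      intro s
      induction s using Finset.induction_on with
      | empty => exact ⟨1, one_pos, by simp⟩
      | insert p s _ ih =>
        obtain ⟨g, hg0, hg⟩ := ih
        by_cases hp : p.2 ∈ O ∧ p.1 ∉ S
        · refine ⟨min g (θ.payoff a₀ p.2 - θ.payoff p.1 p.2),
            lt_min hg0 (sub_pos.2 (hlt _ hp.1 _ hp.2)), fun r hr h1 h2 => ?_⟩
          rcases Finset.mem_insert.1 hr with rfl | hr
          · linarith [min_le_right g (θ.payoff a₀ r.2 - θ.payoff r.1 r.2)]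
          · linarith [hg r hr h1 h2, min_le_left g (θ.payoff a₀ p.2 - θ.payoff p.1 p.2)]
        · refine ⟨g, hg0, fun r hr h1 h2 => ?_⟩
          rcases Finset.mem_insert.1 hr with rfl | hr
          · exact absurd ⟨h1, h2⟩ hp
          · exact hg r hr h1 h2
    obtain ⟨g, hg0, hg⟩ := hfin Finset.univ
    exact ⟨g, hg0, fun ω hω a ha => hg (a, ω) (Finset.mem_univ _) hω ha⟩
  have h1δ : 0 < 1 - δ := sub_pos.2 hδ1
  -- Leaving `S` costs at least `g` on `O`; the total possible gain is at most `K / (1 - δ)` per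
  -- unit of mass outside `O`. The `+ 1` keeps the denominator positive and the comparison strict
  -- when `K = 0`.
  refine ⟨g / (K / (1 - δ) + 1), by positivity, fun π hπ a ha => ?_⟩
  by_contra haS
  set x := θ.mean (fun ω => if ω ∈ O then 0 else 1) π with hx
  set z := θ.mean (fun ω => if ω ∈ O then 1 else 0) π with hz
  have hx0 : 0 ≤ x := by
    rw [← θ.mean_const 0 π]
    exact θ.mean_mono (fun ω => by split_ifs <;> norm_num) π
  obtain ⟨U, hU, hopt⟩ := ha
  have hbm := isBoundedMeasurable_of_isValueFunction hU
  -- The lower bound is the value of playing `a₀` forever; the upper bound adds a premium of `K` per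
  -- period outside `O`.
  have hlow := θ.mean_le_of_isValueFunction hδ0 hδ1 hU
    (fun ω => (1 - δ)⁻¹ * θ.payoff a₀ ω) a₀ (fun ω => le_of_eq (by field_simp; ring))
  have hup := θ.le_mean_of_isValueFunction hδ0 hδ1 hU
    (fun ω => (1 - δ)⁻¹ * (θ.payoff a₀ ω + K * if ω ∈ O then 0 else 1)) (by
      intro a ω
      have : θ.payoff a ω ≤ θ.payoff a₀ ω + K * if ω ∈ O then 0 else 1 := by
        split_ifs with hω
        · simpa using hle ω hω a
        · linarith [(abs_le.1 (hK a ω)).2]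
      refine (add_le_add_left this _).trans (le_of_eq ?_)
      field_simp; ring)
  have hval : U π ≤ θ.mean (θ.payoff a) π + δ * θ.continuation U a π := by
    obtain ⟨b, hb⟩ := (hU.2.2 π).1
    rw [← hb, ← θ.objective_eq hbm]
    exact hopt b
  have hcont := θ.continuation_mono hbm (θ.isBoundedMeasurable_mean _) hup a π
  rw [θ.continuation_mean, θ.mean_const_mul, θ.mean_add, θ.mean_const_mul, ← hx] at hcont
  have hlowπ := hlow π
  rw [θ.mean_const_mul] at hlowπ
  have hdiff : θ.mean (θ.payoff a) π ≤ θ.mean (θ.payoff a₀) π + (K * x - g * z) := by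
    rw [hx, hz, ← θ.mean_const_mul, ← θ.mean_const_mul, ← θ.mean_sub, ← θ.mean_add]
    refine θ.mean_mono (fun ω => ?_) π
    split_ifs with hω
    · linarith [hg ω hω a haS]
    · linarith [(abs_le.1 (hK a ω)).2]
  have hgz : (K / (1 - δ) + 1) * x < g * z := by
    rw [div_mul_eq_mul_div, lt_div_iff₀ (by positivity)] at hπ
    linarith
  have h5 := mul_le_mul_of_nonneg_left hcont hδ0
  set p := θ.mean (θ.payoff a₀) π
  have e1 : (1 - δ)⁻¹ * p = p + δ * ((1 - δ)⁻¹ * p) := by field_simp; ring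
  have e2 : δ * ((1 - δ)⁻¹ * (p + K * x)) + K * x
      = δ * ((1 - δ)⁻¹ * p) + K / (1 - δ) * x := by field_simp; ring
  linarith

end SubjectiveModel

/-! ### Endogenous histories and Ville's inequality along them -/

namespace Environment

variable {A Y : Type*} [MeasurableSpace Y]

/-- The history generated by the decision rule `φ` and the potential outcomes `s`. -/
def path (φ : List (A × Y) → A) (s : A × ℕ → Y) : ℕ → List (A × Y)
  | 0 => []
  | t + 1 => (φ (path φ s t), s (φ (path φ s t), t)) :: path φ s t

/-- Before period `t`, the actions of the rule `φ` depend measurably on past outcomes. -/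
def AdaptedBefore (φ : List (A × Y) → A) (t : ℕ) : Prop :=
  ∀ j < t, ∀ a, MeasurableSet[pastFiltration A Y j] {s | φ (path φ s j) = a}

variable [Fintype A]

/-- Histories carry no σ-algebra; measurability is tracked through products of one-step factors,
from which likelihoods and posteriors are built. Assuming adaptedness only before `t` lets
adaptedness itself be proved by induction. -/
theorem measurable_path_prod {φ : List (A × Y) → A} {t : ℕ} (hφ : AdaptedBefore φ t)
    {k : A → Y → ℝ} (hk : ∀ a, Measurable (k a)) :
    Measurable[pastFiltration A Y t] fun s =>
      ((path φ s t).map fun p => k p.1 p.2).prod := by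
  classical
  induction t with
  | zero => exact measurable_const
  | succ t ih =>
    have hmono : (pastFiltration A Y t : MeasurableSpace (A × ℕ → Y)) ≤ pastFiltration A Y (t + 1) :=
      (pastFiltration A Y).mono (Nat.le_succ t)
    have h1 := (ih fun j hj => hφ j (by omega)).mono hmono le_rfl
    have h2 : ∀ a, Measurable[pastFiltration A Y (t + 1)]
        ({s | φ (path φ s t) = a}.indicator fun s => k a (s (a, t))) := fun a =>
      Measurable.indicator ((hk a).comp (measurable_coordinate a t))
        (hmono _ (hφ t (Nat.lt_succ_self t) a))
    have h3 : (fun s : A × ℕ → Y => k (φ (path φ s t)) (s (φ (path φ s t), t)))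
        = fun s => ∑ a, {s | φ (path φ s t) = a}.indicator (fun s => k a (s (a, t))) s := by
      ext s
      rw [Finset.sum_eq_single (φ (path φ s t))]
      · symm
        exact Set.indicator_of_mem (show s ∈ {s' | φ (path φ s' t) = φ (path φ s t)} from rfl)
          fun s' => k (φ (path φ s t)) (s' (φ (path φ s t), t))
      · exact fun a _ ha => Set.indicator_of_notMem
          (show s ∉ {s' | φ (path φ s' t) = a} from fun h => ha h.symm) _
      · exact fun h => absurd (Finset.mem_univ _) h
    have h4 : Measurable[pastFiltration A Y (t + 1)]
        fun s : A × ℕ → Y => k (φ (path φ s t)) (s (φ (path φ s t), t)) := by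
      rw [h3]
      exact Finset.measurable_fun_sum _ fun a _ => h2 a
    exact h4.mul h1

/-- Ville's inequality for mixtures of likelihood ratios along the generated history. -/
theorem prob_exists_one_le_mixture (E : Environment A Y) {φ : List (A × Y) → A}
    (hφ : ∀ t, AdaptedBefore φ t) {ι : Type*} [Fintype ι] (w : ι → ℝ) (hw : ∀ i, 0 ≤ w i)
    (k : ι → A → Y → ℝ) (hk : ∀ i a, Measurable (k i a)) (hk0 : ∀ i a y, 0 ≤ k i a y)
    (hk1 : ∀ i a, ∫⁻ y, ENNReal.ofReal (k i a y) ∂E.law a = 1) :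
    E.prob {s | ∃ t, 1 ≤ ∑ i, w i * ((path φ s t).map fun p => k i p.1 p.2).prod}
      ≤ ENNReal.ofReal (∑ i, w i) := by
  set G : ι → ℕ → (A × ℕ → Y) → ℝ := fun i t s => ((path φ s t).map fun p => k i p.1 p.2).prod
    with hG
  have hG0 : ∀ i t s, 0 ≤ G i t s := fun i t s =>
    List.prod_nonneg fun x hx => by
      obtain ⟨p, -, rfl⟩ := List.mem_map.1 hx
      exact hk0 _ _ _
  have hGm : ∀ i t, Measurable[pastFiltration A Y t] (G i t) := fun i t =>
    measurable_path_prod (hφ t) (hk i)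
  have hGm' : ∀ i t, Measurable (G i t) := fun i t =>
    (hGm i t).mono ((pastFiltration A Y).le t) le_rfl
  have hstep : ∀ i t (B : Set (A × ℕ → Y)), MeasurableSet[pastFiltration A Y t] B →
      ∫⁻ s in B, ENNReal.ofReal (G i (t + 1) s) ∂E.prob
        = ∫⁻ s in B, ENNReal.ofReal (G i t s) ∂E.prob := by
    intro i t B hB
    rw [← E.setLIntegral_mul_chosen_coordinate t (c := fun s => φ (path φ s t))
      (fun a => hφ (t + 1) t (Nat.lt_succ_self t) a) (hGm i t).ennreal_ofReal
      (r := fun a y => ENNReal.ofReal (k i a y)) (fun a => (hk i a).ennreal_ofReal) (hk1 i) hB]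
    refine lintegral_congr fun s => ?_
    rw [← ENNReal.ofReal_mul (hG0 i t s), mul_comm (G i t s)]
    rfl
  have hZ : ∀ t s, ENNReal.ofReal (∑ i, w i * G i t s)
      = ∑ i, ENNReal.ofReal (w i) * ENNReal.ofReal (G i t s) := by
    intro t s
    rw [ENNReal.ofReal_sum_of_nonneg fun i _ => mul_nonneg (hw i) (hG0 i t s)]
    exact Finset.sum_congr rfl fun i _ => ENNReal.ofReal_mul (hw i)
  have hville := measure_exists_one_le_of_supermartingale E.prob (pastFiltration A Y)
    (fun t s => ENNReal.ofReal (∑ i, w i * G i t s))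
    (fun t => (Finset.measurable_fun_sum _ fun i _ => (hGm i t).const_mul (w i)).ennreal_ofReal)
    (by
      intro t B hB
      simp_rw [hZ]
      rw [lintegral_finsetSum _ fun i _ => ((hGm' i _).ennreal_ofReal.const_mul _),
        lintegral_finsetSum _ fun i _ => ((hGm' i _).ennreal_ofReal.const_mul _)]
      refine le_of_eq (Finset.sum_congr rfl fun i _ => ?_)
      rw [lintegral_const_mul _ (hGm' i _).ennreal_ofReal,
        lintegral_const_mul _ (hGm' i _).ennreal_ofReal, hstep i t B hB])
  have h0 : ∀ i s, G i 0 s = 1 := fun i s => rfl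
  simpa [h0] using hville

end Environment

/-! ### Likelihoods and posteriors relative to the truth -/

namespace SubjectiveModel

variable {A Y : Type*} [Fintype A] [MeasurableSpace Y] {E : Environment A Y}

variable (θ : SubjectiveModel E)

/-- The likelihood ratio between the prediction under `ω` and the truth. -/
def ratio (ω : θ.Ω) (a : A) (y : Y) : ℝ := θ.q a ω y / E.q a y

theorem ratio_nonneg (ω : θ.Ω) (a : A) (y : Y) : 0 ≤ θ.ratio ω a y :=
  div_nonneg (θ.q_pos a ω y).le (E.q_pos a y).le

theorem measurable_ratio (ω : θ.Ω) (a : A) : Measurable (θ.ratio ω a) :=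
  (θ.q_measurable a ω).div (E.q_measurable a)

theorem lintegral_ratio (ω : θ.Ω) (a : A) :
    ∫⁻ y, ENNReal.ofReal (θ.ratio ω a y) ∂E.law a = 1 := by
  unfold Environment.law densityLaw
  rw [lintegral_withDensity_eq_lintegral_mul _ (E.q_measurable a).ennreal_ofReal
    (θ.measurable_ratio ω a).ennreal_ofReal]
  have h : θ.law a ω Set.univ = 1 := measure_univ
  unfold law densityLaw at h
  rw [withDensity_apply _ MeasurableSet.univ, Measure.restrict_univ] at h
  rw [← h]
  refine lintegral_congr fun y => ?_
  rw [Pi.mul_apply, ← ENNReal.ofReal_mul (E.q_pos a y).le, ratio,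
    mul_div_cancel₀ _ (E.q_pos a y).ne']

theorem prod_density_eq (ω : θ.Ω) (h : List (A × Y)) :
    (h.map fun p => θ.q p.1 ω p.2).prod
      = (h.map fun p => E.q p.1 p.2).prod * (h.map fun p => θ.ratio ω p.1 p.2).prod := by
  induction h with
  | nil => simp
  | cons p h ih =>
    simp only [List.map_cons, List.prod_cons, ih, ratio]
    have := (E.q_pos p.1 p.2).ne'
    field_simp

theorem prod_density_pos (ω : θ.Ω) (h : List (A × Y)) :
    0 < (h.map fun p => θ.q p.1 ω p.2).prod :=
  List.prod_pos fun x hx => by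
    obtain ⟨p, -, rfl⟩ := List.mem_map.1 hx
    exact θ.q_pos _ _ _

theorem prod_true_density_pos (h : List (A × Y)) : 0 < (h.map fun p => E.q p.1 p.2).prod :=
  List.prod_pos fun x hx => by
    obtain ⟨p, -, rfl⟩ := List.mem_map.1 hx
    exact E.q_pos _ _

/-- The true likelihood is a factor common to both models, so it cancels in Bayes factors and leaves
averages of martingale ratios. -/
theorem likelihood_eq (π₀ : θ.Belief) (h : List (A × Y)) :
    θ.likelihood π₀ h = (h.map fun p => E.q p.1 p.2).prod
      * θ.mean (fun ω => (h.map fun p => θ.ratio ω p.1 p.2).prod) π₀ := by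
  rw [← θ.mean_const_mul]
  simp only [likelihood, mean, θ.prod_density_eq]

theorem exists_belief_pos (π : θ.Belief) : ∃ ω, 0 < π.1 ω := by
  by_contra! hcon
  have := Finset.sum_nonpos fun ω (_ : ω ∈ Finset.univ) => hcon ω
  rw [π.2.2] at this
  linarith

theorem likelihood_pos (π₀ : θ.Belief) (h : List (A × Y)) : 0 < θ.likelihood π₀ h := by
  obtain ⟨ω, hω⟩ := θ.exists_belief_pos π₀
  exact Finset.sum_pos' (fun ω _ => mul_nonneg (π₀.2.1 ω) (θ.prod_density_pos ω h).le)
    ⟨ω, Finset.mem_univ _, mul_pos hω (θ.prod_density_pos ω h)⟩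

theorem posterior_apply (π₀ : θ.Belief) (h : List (A × Y)) (ω : θ.Ω) :
    (θ.posterior π₀ h).1 ω
      = π₀.1 ω * (h.map fun p => θ.q p.1 ω p.2).prod / θ.likelihood π₀ h := by
  induction h generalizing ω with
  | nil =>
    have h1 : ∑ ω, π₀.1 ω = 1 := π₀.2.2
    simp only [likelihood, List.map_nil, List.prod_nil, mul_one, h1, div_one]
    rfl
  | cons p h ih =>
    have hL := (θ.likelihood_pos π₀ h).ne'
    have hL' := (θ.likelihood_pos π₀ (p :: h)).ne'
    -- One-step normalizers are quotients of successive likelihoods, so they telescope.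
    have hpred : θ.predictive p.1 p.2 (θ.posterior π₀ h)
        = θ.likelihood π₀ (p :: h) / θ.likelihood π₀ h := by
      rw [predictive, likelihood, Finset.sum_div]
      refine Finset.sum_congr rfl fun ω _ => ?_
      rw [ih, List.map_cons, List.prod_cons]
      ring
    change (θ.posterior π₀ h).1 ω * θ.q p.1 ω p.2 / θ.predictive p.1 p.2 (θ.posterior π₀ h) = _
    rw [hpred, ih, List.map_cons, List.prod_cons]
    field_simp

/-- The prefactor does not depend on `c`, so posterior odds reduce to comparing prior averages of
ratios. -/
theorem mean_posterior (π₀ : θ.Belief) (h : List (A × Y)) (c : θ.Ω → ℝ) :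
    θ.mean c (θ.posterior π₀ h) = (h.map fun p => E.q p.1 p.2).prod / θ.likelihood π₀ h
      * θ.mean (fun ω => c ω * (h.map fun p => θ.ratio ω p.1 p.2).prod) π₀ := by
  simp only [mean, θ.posterior_apply, θ.prod_density_eq, Finset.mul_sum]
  exact Finset.sum_congr rfl fun ω _ => by ring

/-! ### The switcher's process and persistence -/

section Switcher

open Environment

variable (θc : SubjectiveModel E) (α : ℝ) (π₀ : θ.Belief) (π₀c : θc.Belief)
  (f : θ.Belief → A) (fc : θc.Belief → A)

theorem switcherHistory_eq_path (s : A × ℕ → Y) (t : ℕ) :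
    switcherHistory θ θc α π₀ π₀c f fc s t
      = path (switcherAction θ θc α π₀ π₀c f fc) s t := by
  induction t with
  | zero => rfl
  | succ t ih => simp only [switcherHistory, path, ih]

variable {θ}

theorem measurable_likelihood {φ : List (A × Y) → A} {t : ℕ} (hφ : AdaptedBefore φ t) :
    Measurable[pastFiltration A Y t] fun s => θ.likelihood π₀ (path φ s t) :=
  Finset.measurable_fun_sum _ fun ω _ => Measurable.const_mul
    (measurable_path_prod hφ (k := fun a => θ.q a ω) fun a => θ.q_measurable a ω) _

theorem measurable_posterior {φ : List (A × Y) → A} {t : ℕ} (hφ : AdaptedBefore φ t) :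
    Measurable[pastFiltration A Y t] fun s => θ.posterior π₀ (path φ s t) := by
  have h : Measurable[pastFiltration A Y t] fun s => (θ.posterior π₀ (path φ s t)).1 := by
    refine @measurable_pi_lambda _ _ _ (pastFiltration A Y t) _ _ fun ω => ?_
    simp_rw [θ.posterior_apply]
    exact Measurable.div (Measurable.const_mul
      (measurable_path_prod hφ (k := fun a => θ.q a ω) fun a => θ.q_measurable a ω) _)
      (measurable_likelihood π₀ hφ)
  exact h.subtype_mk

variable {θc}

theorem measurableSet_modelChoice {φ : List (A × Y) → A} {t : ℕ} (hφ : AdaptedBefore φ t) :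
    MeasurableSet[pastFiltration A Y t]
      {s | modelChoice θ θc α π₀ π₀c (path φ s t) = ModelLabel.initial} := by
  induction t with
  | zero => simp [path, modelChoice]
  | succ t ih =>
    have h1 := (pastFiltration A Y).mono (Nat.le_succ t) _ (ih fun j hj => hφ j (by omega))
    have hl := measurable_likelihood π₀ hφ
    have hlc := measurable_likelihood π₀c hφ
    have h2 : MeasurableSet[pastFiltration A Y (t + 1)] {s | α < θc.likelihood π₀c (path φ s (t + 1))
        / θ.likelihood π₀ (path φ s (t + 1))} := (hlc.div hl) measurableSet_Ioi
    have h3 : MeasurableSet[pastFiltration A Y (t + 1)] {s | α < θ.likelihood π₀ (path φ s (t + 1))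
        / θc.likelihood π₀c (path φ s (t + 1))} := (hl.div hlc) measurableSet_Ioi
    convert (h1.inter h2.compl).union (h1.compl.inter h3) using 1
    ext s
    simp only [Set.mem_ofPred_eq, Set.mem_union, Set.mem_inter_iff, Set.mem_compl_iff]
    rw [path, modelChoice]
    cases modelChoice θ θc α π₀ π₀c (path φ s t) <;> simp

/-- Adaptedness before `t` makes likelihoods and posteriors at `t` measurable with respect to the
past, hence also the model choice and the action at `t`. -/
theorem adaptedBefore_switcherAction (hf : ∀ a, MeasurableSet (f ⁻¹' {a}))
    (hfc : ∀ a, MeasurableSet (fc ⁻¹' {a})) (t : ℕ) :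
    AdaptedBefore (switcherAction θ θc α π₀ π₀c f fc) t := by
  induction t with
  | zero => exact fun j hj => absurd hj (Nat.not_lt_zero j)
  | succ t ih =>
    intro j hj a
    rcases Nat.lt_succ_iff_lt_or_eq.1 hj with hj | rfl
    · exact ih j hj a
    have h1 := measurableSet_modelChoice α π₀ π₀c ih
    have h2 := measurable_posterior π₀ ih (hf a)
    have h3 := measurable_posterior π₀c ih (hfc a)
    convert (h1.inter h2).union (h1.compl.inter h3) using 1
    ext s
    simp only [Set.mem_ofPred_eq, Set.mem_union, Set.mem_inter_iff, Set.mem_compl_iff,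
      Set.mem_preimage, Set.mem_singleton_iff]
    nth_rewrite 1 [switcherAction]
    cases modelChoice θ θc α π₀ π₀c
      (path (switcherAction θ θc α π₀ π₀c f fc) s j) <;> simp

open Classical in
/-- If the parameters in `O` fit perfectly under the actions in `S`, the policy prescribes
actions in `S` when the odds against `O` are below `η`, and the prior is sufficiently
concentrated on `O`, then with positive probability the initial model is never abandoned. -/
theorem persistsAgainst_of_concentrated (O : Set θ.Ω) (S : Set A) {η : ℝ} (hη : 0 < η)
    (hα : 0 < α) (hO : ∀ ω ∈ O, ∀ a ∈ S, ∀ᵐ y ∂E.law a, θ.q a ω y = E.q a y)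
    (hS : ∀ π : θ.Belief,
      θ.mean (fun ω => if ω ∈ O then 0 else 1) π < η * θ.mean (fun ω => if ω ∈ O then 1 else 0) π →
      f π ∈ S)
    (hf : ∀ a, MeasurableSet (f ⁻¹' {a})) (hfc : ∀ a, MeasurableSet (fc ⁻¹' {a}))
    (hc0 : 0 < θ.mean (fun ω => if ω ∈ O then 1 else 0) π₀)
    (hprior : θ.mean (fun ω => if ω ∈ O then 0 else 1) π₀ / η + 1 / α
      < θ.mean (fun ω => if ω ∈ O then 1 else 0) π₀) :
    PersistsAgainst θ θc α π₀ π₀c f fc := by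
  set φ := switcherAction θ θc α π₀ π₀c f fc with hφdef
  set c₀ := θ.mean (fun ω => if ω ∈ O then 1 else 0) π₀ with hc₀
  have had := adaptedBefore_switcherAction (θ := θ) (θc := θc) α π₀ π₀c f fc hf hfc
  -- Normalized so that a mixture below 1 keeps the ratio mass outside `O` below `η * c₀` and the
  -- competitor's average ratio below `α * c₀`.
  set w : θ.Ω ⊕ θc.Ω → ℝ := Sum.elim
    (fun ω => π₀.1 ω * (if ω ∈ O then 0 else 1) / (η * c₀)) (fun ω => π₀c.1 ω / (α * c₀)) with hw
  set k : θ.Ω ⊕ θc.Ω → A → Y → ℝ := Sum.elim θ.ratio θc.ratio with hk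
  have hw0 : ∀ i, 0 ≤ w i := by
    rintro (ω | ω)
    · have := π₀.2.1 ω
      simp only [hw, Sum.elim_inl]
      split_ifs <;> positivity
    · have := π₀c.2.1 ω
      simp only [hw, Sum.elim_inr]
      positivity
  have hville := E.prob_exists_one_le_mixture had w hw0 k
    (by rintro (ω | ω) a; exacts [θ.measurable_ratio ω a, θc.measurable_ratio ω a])
    (by rintro (ω | ω) a y; exacts [θ.ratio_nonneg ω a y, θc.ratio_nonneg ω a y])
    (by rintro (ω | ω) a; exacts [θ.lintegral_ratio ω a, θc.lintegral_ratio ω a])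
  have hwsum : ∑ i, w i < 1 := by
    have h1 : ∑ ω, π₀c.1 ω = 1 := π₀c.2.2
    rw [Fintype.sum_sum_type]
    simp only [hw, Sum.elim_inl, Sum.elim_inr]
    rw [← Finset.sum_div, ← Finset.sum_div, h1]
    change θ.mean (fun ω => if ω ∈ O then 0 else 1) π₀ / (η * c₀) + 1 / (α * c₀) < 1
    rw [← div_div, ← div_div, ← add_div, div_lt_one hc0]
    exact hprior
  -- Perfect fit is required at all potential outcomes of `S`, realized or not, so this event has
  -- full measure independently of the play.
  set good : Set (A × ℕ → Y) := {s | ∀ ω ∈ O, ∀ a ∈ S, ∀ t, θ.q a ω (s (a, t)) = E.q a (s (a, t))}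
    with hgood
  have hgood_ae : E.prob goodᶜ = 0 := by
    change ∀ᵐ s ∂E.prob, s ∈ good
    have : ∀ ω : θ.Ω, ∀ a, ∀ t : ℕ, ∀ᵐ s ∂E.prob,
        ω ∈ O → a ∈ S → θ.q a ω (s (a, t)) = E.q a (s (a, t)) := by
      intro ω a t
      by_cases hω : ω ∈ O
      · by_cases ha : a ∈ S
        · filter_upwards [(E.measurePreserving_coordinate (a, t)).quasiMeasurePreserving.ae
            (hO ω hω a ha)] with s hs _ _ using hs
        · exact Eventually.of_forall fun s _ h => absurd h ha
      · exact Eventually.of_forall fun s h => absurd h hω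
    simp_rw [← ae_all_iff] at this
    filter_upwards [this] with s hs ω hω a ha t using hs ω a t hω ha
  -- A joint induction: under the initial model, low odds against `O` force an action in `S`; the
  -- ratios on `O` then stay 1, which bounds the initial model's likelihood below by `c₀` times the
  -- true one and keeps the competitor's Bayes factor at most `α`.
  have hpersist : ∀ s ∈ good,
      (∀ t, ∑ i, w i * ((path φ s t).map fun p => k i p.1 p.2).prod < 1) →
      ∀ t, modelChoice θ θc α π₀ π₀c (path φ s t) = ModelLabel.initial ∧
        ∀ p ∈ path φ s t, ∀ ω ∈ O, θ.ratio ω p.1 p.2 = 1 := by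
    intro s hs hlt t
    have hprod0 : ∀ (θ' : SubjectiveModel E) (ω : θ'.Ω) (h : List (A × Y)),
        0 ≤ (h.map fun p => θ'.ratio ω p.1 p.2).prod := fun θ' ω h =>
      List.prod_nonneg fun x hx => by
        obtain ⟨p, -, rfl⟩ := List.mem_map.1 hx
        exact θ'.ratio_nonneg ω _ _
    have hbounds : ∀ t,
        θ.mean (fun ω => (if ω ∈ O then 0 else 1)
          * ((path φ s t).map fun p => θ.ratio ω p.1 p.2).prod) π₀ < η * c₀ ∧
        θc.mean (fun ω => ((path φ s t).map fun p => θc.ratio ω p.1 p.2).prod) π₀c < α * c₀ := by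
      intro t
      have h1 := hlt t
      rw [Fintype.sum_sum_type] at h1
      simp only [hw, hk, Sum.elim_inl, Sum.elim_inr, div_mul_eq_mul_div, mul_assoc] at h1
      rw [← Finset.sum_div, ← Finset.sum_div] at h1
      change θ.mean _ π₀ / (η * c₀) + θc.mean _ π₀c / (α * c₀) < 1 at h1
      have h2 : 0 ≤ θ.mean (fun ω => (if ω ∈ O then 0 else 1)
          * ((path φ s t).map fun p => θ.ratio ω p.1 p.2).prod) π₀ / (η * c₀) := by
        refine div_nonneg (Finset.sum_nonneg fun ω _ => mul_nonneg (π₀.2.1 ω) ?_) (by positivity)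
        exact mul_nonneg (by split_ifs <;> norm_num) (hprod0 θ ω _)
      have h3 : 0 ≤ θc.mean (fun ω => ((path φ s t).map fun p => θc.ratio ω p.1 p.2).prod) π₀c
          / (α * c₀) :=
        div_nonneg (Finset.sum_nonneg fun ω _ => mul_nonneg (π₀c.2.1 ω) (hprod0 θc ω _))
          (by positivity)
      constructor
      · rw [← div_lt_one (by positivity)]
        exact lt_of_le_of_lt (le_add_of_nonneg_right h3) h1
      · rw [← div_lt_one (by positivity)]
        exact lt_of_le_of_lt (le_add_of_nonneg_left h2) h1
    have hfit : ∀ t, (∀ p ∈ path φ s t, ∀ ω ∈ O, θ.ratio ω p.1 p.2 = 1) → ∀ ω ∈ O,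
        ((path φ s t).map fun p => θ.ratio ω p.1 p.2).prod = 1 := by
      intro t h ω hω
      refine List.prod_eq_one fun x hx => ?_
      obtain ⟨p, hp, rfl⟩ := List.mem_map.1 hx
      exact h p hp ω hω
    have hmean : ∀ t, (∀ p ∈ path φ s t, ∀ ω ∈ O, θ.ratio ω p.1 p.2 = 1) →
        θ.mean (fun ω => (if ω ∈ O then 1 else 0)
          * ((path φ s t).map fun p => θ.ratio ω p.1 p.2).prod) π₀ = c₀ := by
      intro t h
      refine Finset.sum_congr rfl fun ω _ => ?_
      by_cases hω : ω ∈ O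
      · simp only [hω, if_true, hfit t h ω hω, mul_one]
      · simp only [hω, if_false, zero_mul]
    induction t with
    | zero => exact ⟨rfl, fun p hp => absurd hp (List.not_mem_nil)⟩
    | succ t ih =>
      obtain ⟨hmc, hratio⟩ := ih
      have hact : φ (path φ s t) ∈ S := by
        have : φ (path φ s t) = f (θ.posterior π₀ (path φ s t)) := by
          rw [hφdef, switcherAction, ← hφdef, hmc]
        rw [this]
        refine hS _ ?_
        rw [θ.mean_posterior, θ.mean_posterior, hmean t hratio, mul_left_comm]
        exact mul_lt_mul_of_pos_left (hbounds t).1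
          (div_pos (prod_true_density_pos _) (θ.likelihood_pos _ _))
      have hratio' : ∀ p ∈ path φ s (t + 1), ∀ ω ∈ O, θ.ratio ω p.1 p.2 = 1 := by
        intro p hp ω hω
        rcases List.mem_cons.1 hp with rfl | hp
        · rw [ratio, hs ω hω _ hact t, div_self (E.q_pos _ _).ne']
        · exact hratio p hp ω hω
      refine ⟨?_, hratio'⟩
      have hnot : ¬ α < θc.likelihood π₀c (path φ s (t + 1))
          / θ.likelihood π₀ (path φ s (t + 1)) := by
        rw [not_lt, div_le_iff₀ (θ.likelihood_pos _ _), θ.likelihood_eq, θc.likelihood_eq,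
          mul_left_comm]
        refine mul_le_mul_of_nonneg_left ((hbounds (t + 1)).2.le.trans ?_)
          (prod_true_density_pos _).le
        refine mul_le_mul_of_nonneg_left ?_ hα.le
        rw [← hmean (t + 1) hratio']
        refine θ.mean_mono (fun ω => ?_) π₀
        exact mul_le_of_le_one_left (hprod0 θ ω _) (by split_ifs <;> norm_num)
      rw [path] at hnot ⊢
      rw [modelChoice, hmc]
      simp only [hnot, if_false]
  -- Covering the whole space needs only subadditivity of outer measure, so measurability of the
  -- persistence event plays no role.
  have hcover : (Set.univ : Set (A × ℕ → Y)) ⊆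
      ({s | ∃ t, 1 ≤ ∑ i, w i * ((path φ s t).map fun p => k i p.1 p.2).prod} ∪ goodᶜ)
        ∪ {s | ∀ᶠ t in atTop, modelChoice θ θc α π₀ π₀c
            (switcherHistory θ θc α π₀ π₀c f fc s t) = ModelLabel.initial} := by
    intro s _
    by_cases hs : s ∈ good
    · by_cases hex : ∃ t, 1 ≤ ∑ i, w i * ((path φ s t).map fun p => k i p.1 p.2).prod
      · exact Or.inl (Or.inl hex)
      · refine Or.inr (Eventually.of_forall fun t => ?_)
        rw [switcherHistory_eq_path]
        exact (hpersist s hs (fun t => not_le.1 fun h => hex ⟨t, h⟩) t).1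
    · exact Or.inl (Or.inr hs)
  refine pos_iff_ne_zero.2 fun hzero => ?_
  have h1 := (measure_mono (μ := E.prob) hcover).trans
    ((measure_union_le _ _).trans (add_le_add_left (measure_union_le _ _) _))
  rw [hzero, hgood_ae, add_zero, add_zero, measure_univ] at h1
  exact absurd (h1.trans hville) (not_le.2 (ENNReal.ofReal_lt_one.2 hwsum))

end Switcher

/-! ### Concentrated priors and consequences of equilibrium -/

open Classical in
/-- The belief concentrated on one parameter. -/
def pointBelief (ω : θ.Ω) : θ.Belief := ⟨Pi.single ω 1, single_mem_stdSimplex ℝ ω⟩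

theorem mean_pointBelief (ω : θ.Ω) (c : θ.Ω → ℝ) : θ.mean c (θ.pointBelief ω) = c ω := by
  classical
  unfold mean pointBelief
  rw [Finset.sum_eq_single ω (fun b _ hb => by simp [hb]) (by simp)]
  simp

theorem pointBelief_pos {ω ω' : θ.Ω} (h : 0 < (θ.pointBelief ω).1 ω') : ω' = ω := by
  classical
  by_contra hne
  simp [pointBelief, hne] at h

/-- A full-support prior that is almost concentrated on one parameter. -/
theorem exists_fullSupport_mean (ω₀ : θ.Ω) {β : ℝ} (hβ0 : 0 < β) (hβ1 : β < 1) :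
    ∃ π : θ.Belief, θ.FullSupport π ∧
      ∀ c : θ.Ω → ℝ, (∀ ω, 0 ≤ c ω) → (1 - β) * c ω₀ ≤ θ.mean c π := by
  -- The prior mixes the point belief, weight `1 - β`, with the uniform belief, weight `β`.
  have hn : (0 : ℝ) < Fintype.card θ.Ω := by
    have : Nonempty θ.Ω := ⟨ω₀⟩
    exact_mod_cast Fintype.card_pos
  have hpt := (θ.pointBelief ω₀).2
  have hsum : ∑ ω, ((1 - β) * (θ.pointBelief ω₀).1 ω + β / Fintype.card θ.Ω) = 1 := by
    rw [Finset.sum_add_distrib, ← Finset.mul_sum, hpt.2, Finset.sum_const, Finset.card_univ,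
      nsmul_eq_mul]
    field_simp
    ring
  have hpos : ∀ ω, 0 < (1 - β) * (θ.pointBelief ω₀).1 ω + β / Fintype.card θ.Ω := fun ω =>
    add_pos_of_nonneg_of_pos (mul_nonneg (by linarith) (hpt.1 ω)) (by positivity)
  refine ⟨⟨_, fun ω => (hpos ω).le, hsum⟩, hpos, fun c hc => ?_⟩
  rw [← θ.mean_pointBelief ω₀ c]
  unfold mean
  rw [Finset.mul_sum]
  refine Finset.sum_le_sum fun ω _ => ?_
  rw [← mul_assoc]
  exact mul_le_mul_of_nonneg_right (le_add_of_nonneg_right (by positivity)) (hc ω)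

theorem law_eq_of_ae_eq {a : A} {ω : θ.Ω} (h : E.q a =ᵐ[E.ν] θ.q a ω) :
    E.law a = θ.law a ω :=
  withDensity_congr_ae (h.mono fun y hy => by simp only [hy])

theorem ae_eq_of_law_eq {a : A} {ω : θ.Ω} (h : E.law a = θ.law a ω) :
    ∀ᵐ y ∂E.law a, θ.q a ω y = E.q a y := by
  -- `ν` is not assumed σ-finite; finite total mass is what makes the density unique.
  have h1 : ∫⁻ y, ENNReal.ofReal (E.q a y) ∂E.ν ≠ ∞ := by
    have : E.law a Set.univ = 1 := measure_univ
    unfold Environment.law densityLaw at this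
    rw [withDensity_apply _ MeasurableSet.univ, Measure.restrict_univ] at this
    simp [this]
  have h2 := (withDensity_eq_iff (E.q_measurable a).ennreal_ofReal.aemeasurable
    (θ.q_measurable a ω).ennreal_ofReal.aemeasurable h1).1 h
  refine (withDensity_absolutelyContinuous E.ν _).ae_le ?_
  filter_upwards [h2] with y hy
  exact ((ENNReal.ofReal_eq_ofReal_iff (E.q_pos a y).le (θ.q_pos a ω y).le).1 hy).symm

/-- In a self-confirming equilibrium every KL minimizer predicts the truth on path. -/
theorem law_eq_of_mem_klMinimizers {σ : stdSimplex ℝ A} (hσ : θ.IsSelfConfirming σ) {ω : θ.Ω}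
    (hω : ω ∈ θ.klMinimizers σ) {a : A} (ha : a ∈ strategySupport σ) :
    E.law a = θ.law a ω := by
  obtain ⟨-, π, -, -, hq⟩ := hσ
  obtain ⟨ω₀, hω₀⟩ := θ.exists_belief_pos π
  -- The equilibrium belief charges a parameter of zero divergence: perfect fit on the support, zero
  -- weight off it, even where the divergence is infinite.
  have h0 : θ.weightedKL σ ω₀ = 0 := by
    refine Finset.sum_eq_zero fun b _ => ?_
    by_cases hb : b ∈ strategySupport σ
    · rw [← θ.law_eq_of_ae_eq (hq ω₀ hω₀ b hb), InformationTheory.klDiv_self, mul_zero]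
    · rw [ENNReal.ofReal_of_nonpos (not_lt.1 hb), zero_mul]
  have h1 : θ.weightedKL σ ω = 0 := le_antisymm ((hω ω₀).trans_eq h0) zero_le
  have h2 := (Finset.sum_eq_zero_iff.1 h1) a (Finset.mem_univ a)
  rcases mul_eq_zero.1 h2 with h3 | h3
  · exact absurd (ENNReal.ofReal_eq_zero.1 h3) (not_le.2 ha)
  · exact InformationTheory.klDiv_eq_zero_iff.1 h3

/-- A point belief on a minimizer is an admissible test belief; uniformity thus yields strict losses
outside the support parameter by parameter. -/
theorem mem_strategySupport_iff_of_isUniformlyQuasiStrict {σ : stdSimplex ℝ A}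
    (hσ : θ.IsUniformlyQuasiStrict σ) {ω : θ.Ω} (hω : ω ∈ θ.klMinimizers σ) (a : A) :
    a ∈ strategySupport σ ↔ ∀ a', θ.payoff a' ω ≤ θ.payoff a ω := by
  rw [hσ.2 (θ.pointBelief ω) fun ω' h => θ.pointBelief_pos h ▸ hω]
  change (∀ a', θ.mean (θ.payoff a') _ ≤ θ.mean (θ.payoff a) _) ↔ _
  simp_rw [θ.mean_pointBelief]

end SubjectiveModel

end

theorem corollary2 {A Y : Type*} [Fintype A] [MeasurableSpace Y] (E : Environment A Y)
    (δ α : ℝ) (hδ0 : 0 ≤ δ) (hδ1 : δ < 1) (hα : 1 < α) (θ : SubjectiveModel E)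
    (hθ : ∃ σ : stdSimplex ℝ A, θ.IsSelfConfirming σ ∧ θ.IsUniformlyQuasiStrict σ) :
    θ.GloballyRobust δ α := by
  classical
  obtain ⟨σ, hsc, hqs⟩ := hθ
  set S := SubjectiveModel.strategySupport σ
  obtain ⟨a₀, ha₀⟩ : ∃ a, a ∈ S := by
    by_contra! hcon
    have := Finset.sum_nonpos fun a (_ : a ∈ Finset.univ) =>
      show σ.1 a ≤ 0 from not_lt.1 (hcon a)
    rw [σ.2.2] at this
    linarith
  have : Nonempty A := ⟨a₀⟩
  set O := θ.klMinimizers σ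
  obtain ⟨ω₀, hω₀⟩ : ∃ ω, ω ∈ O := by
    obtain ⟨⟨π, hπ, -⟩, -⟩ := hsc
    obtain ⟨ω, hω⟩ := θ.exists_belief_pos π
    exact ⟨ω, hπ ω hω⟩
  have hmem := fun ω (hω : ω ∈ O) => θ.mem_strategySupport_iff_of_isUniformlyQuasiStrict hqs hω
  obtain ⟨η, hη, hηS⟩ := θ.exists_optimalActions_subset hδ0 hδ1 O S a₀
    (fun ω hω => (hmem ω hω a₀).1 ha₀)
    (fun ω hω a ha => by
      by_contra hcon
      exact ha ((hmem ω hω a).2 fun a' => ((hmem ω hω a₀).1 ha₀ a').trans (not_lt.1 hcon)))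
  have hα0 : 0 < α := one_pos.trans hα
  have hα1 : 1 / α < 1 := (div_lt_one hα0).2 hα
  have hα2 : 0 < 1 / α := by positivity
  -- With mass at most `β` outside `O`, the prior condition follows from `β / η + 1 / α < 1 - β`,
  -- that is, `β * (1 / η + 1) < 1 - 1 / α`; the factor 2 gives strictness.
  set β := (1 - 1 / α) / (2 * (1 / η + 1)) with hβ
  have hβ0 : 0 < β := div_pos (by linarith) (by positivity)
  have hβeq : β * (1 / η + 1) = (1 - 1 / α) / 2 := by
    rw [hβ]; field_simp
  have hβη : 0 < β * (1 / η) := by positivity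
  have hβ1 : β < 1 := by linarith
  obtain ⟨π₀, hfull, hmean⟩ := θ.exists_fullSupport_mean ω₀ hβ0 hβ1
  obtain ⟨f, hf⟩ := θ.exists_isOptimalPolicy hδ0 hδ1
  refine ⟨π₀, hfull, f, hf, fun θc π₀c _ fc hfc => ?_⟩
  have hc₀ := hmean (fun ω => if ω ∈ O then 1 else 0) fun ω => by split_ifs <;> norm_num
  simp only [hω₀, if_true, mul_one] at hc₀
  have hx : θ.mean (fun ω => if ω ∈ O then 0 else 1) π₀
      + θ.mean (fun ω => if ω ∈ O then 1 else 0) π₀ = 1 := by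
    rw [← θ.mean_add]
    refine Eq.trans ?_ (θ.mean_const 1 π₀)
    congr 1
    ext ω
    split_ifs <;> norm_num
  refine SubjectiveModel.persistsAgainst_of_concentrated α π₀ π₀c f fc O S hη hα0
    (fun ω hω a ha => θ.ae_eq_of_law_eq (θ.law_eq_of_mem_klMinimizers hsc hω ha))
    (fun π hπ => hηS π hπ (hf.2 π)) hf.1 hfc.1 (by linarith) ?_
  have hxβ : θ.mean (fun ω => if ω ∈ O then 0 else 1) π₀ / η ≤ β * (1 / η) := by
    rw [div_eq_mul_one_div]
    exact mul_le_mul_of_nonneg_right (by linarith) (by positivity)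
  linarith
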